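/- For $x\in\{0,1\}^N$ put $s_i=(-1)^{x_i}$ and let $\mathcal E(x)=\sum_{k=1}^{N-1}\big(\sum_{i=1}^{N-k}s_is_{i+k}\big)^2$ be the LABS sidelobe energy; $x^*$ is an optimal LABS solution if it minimizes $\mathcal E$. For angles $\gamma,\beta\in\mathbb R^d$ the depth-$d$ QAOA unitary is $U_{\rm QAOA}=\prod_{l=d}^{1}\big(e^{-i\beta_l\sum_j X_j}e^{-i\gamma_l H}\big)\,\mathsf H^{\otimes N}$, where $H|x\rangle=\mathcal E(x)|x\rangle$ and $\mathsf H$ is the Hadamard gate; let $|\psi\rangle=U_{\rm QAOA}|0\rangle^{\otimes N}$. Generalized quantum minimum-finding with parameters $C,M>0$ and $\delta\in(0,1)$ (Algorithm 1) makes $\lceil\log_2(1/\delta)\rceil$ independent runs of the following loop and outputs the lowest-energy bitstring among their results. The loop starts with $s_0=\infty$ and repeatedly runs exponential quantum search (EQSearch), with state preparation $U_{\rm QAOA}$ and failure probability $\varepsilon=1/(6\cdot2^N)$, for a bitstring of energy strictly below that of the last one found. It is stopped as soon as its next step would bring the number of calls to $U_{\rm QAOA}$, to the circuit $V_{\rm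 LABS}$ that computes $\mathcal E$ into a register, and to their inverses above $3CMN$; its result is the last bitstring found. EQSearch goes through the scales $1,2,4,8,\dots$; at each scale $m$ it makes $\lceil3\log_2(1/\varepsilon)\rceil$ attempts, each of which prepares $|\psi\rangle$, applies $j$ steps of amplitude amplification with $j$ uniform in $\{0,\dots,m-1\}$, measures, and evaluates the energy of the outcome; it returns the first outcome that is below the threshold. **Theorem.** There is an absolute constant $C_0>0$ such that for every $C\ge C_0$ and every constant depth $d$ there is a polynomial $P$ with the following property. For all $N\ge3$ and all angles $\gamma,\beta\in\mathbb R^d$, Algorithm 1 has an implementation by circuits of one-qubit, CNOT and Toffoli gates on $N$ qubits and ancillas such that, whenever $x^*$ is an optimal LABS solution, $p_{\rm opt}>0$ (in particular, whenever $p_{\rm opt}\ge1/N$), $|\langle x^*|\psi\rangle|\ge\sqrt{p_{\rm opt}}$, $M\ge1/\sqrt{p_{\rm opt}}$ and $\delta\in(0,1)$, Algorithm 1 with parameters $C,M,\delta$ outputs an optimal LABS solution with probability at least $1-\delta$, and the total number of gates that it applies never exceeds $P(N)\,\lceil\log_2(1/\delta)\rceil\,M$; that is, its gate complexity is $O(\mathrm{poly}(N)\log(1/\delta)\,M)$.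 -/

import Mathlib

noncomputable section

namespace LABS

/-! ### The low autocorrelation binary sequences problem -/

/-- Bitstrings of length `N`. -/
abbrev BitString (N : ℕ) : Type := Fin N → Bool

/-- The `±1` entry of the sequence encoded by a bitstring. -/
def spin {N : ℕ} (x : BitString N) (i : Fin N) : ℤ := if x i then -1 else 1

/-- The aperiodic autocorrelation `A_k = ∑_i s_i s_{i+k}`. -/
def autocorrelation {N : ℕ} (x : BitString N) (k : ℕ) : ℤ :=
  ∑ i : Fin N, if h : (i : ℕ) + k < N then spin x i * spin x ⟨(i : ℕ) + k, h⟩ else 0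

/-- The sidelobe energy `∑_{k=1}^{N-1} A_k ^ 2`. -/
def energy {N : ℕ} (x : BitString N) : ℕ :=
  ∑ k ∈ Finset.Icc 1 (N - 1), (autocorrelation x k).natAbs ^ 2

/-- `x` is an optimal solution of the `N`-bit problem. -/
def IsOptimal {N : ℕ} (x : BitString N) : Prop := ∀ y : BitString N, energy x ≤ energy y

/-! ### The QAOA unitary -/

/-- `H^{⊗N}`. -/
def hadamardAll (N : ℕ) : Matrix (BitString N) (BitString N) ℂ :=
  Matrix.of fun x y => ∏ i : Fin N, (((Real.sqrt 2)⁻¹ : ℝ) : ℂ) * (if x i && y i then -1 else 1)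

/-- The phase operator `exp(-i γ H)`, with `H` diagonal with the sidelobe energies as entries. -/
def phaseOperator (N : ℕ) (γ : ℝ) : Matrix (BitString N) (BitString N) ℂ :=
  Matrix.diagonal fun x => Complex.exp (-(Complex.I * (γ : ℂ) * (energy x : ℂ)))

/-- The transverse-field mixer `exp(-i β ∑_i X_i) = (exp(-i β X))^{⊗N}`, where
`exp(-i β X) = cos β - i sin β X`. -/
def mixer (N : ℕ) (β : ℝ) : Matrix (BitString N) (BitString N) ℂ :=
  Matrix.of fun x y => ∏ i : Fin N,
    if x i = y i then (Real.cos β : ℂ) else -(Complex.I * (Real.sin β : ℂ))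

/-- The QAOA unitary with `d` layers (and angles `γ`, `β`), including the preparation of the uniform
superposition: `exp(-i β_d B) exp(-i γ_d H) ⋯ exp(-i β_1 B) exp(-i γ_1 H) H^{⊗N}`. -/
def qaoaUnitary (N : ℕ) :
    (d : ℕ) → (γ β : Fin d → ℝ) → Matrix (BitString N) (BitString N) ℂ
  | 0, _, _ => hadamardAll N
  | d + 1, γ, β =>
      mixer N (β (Fin.last d)) * phaseOperator N (γ (Fin.last d)) *
        qaoaUnitary N d (fun i => γ i.castSucc) (fun i => β i.castSucc)

/-- The amplitude `⟨x|ψ⟩` of the QAOA state `|ψ⟩ = U|0…0⟩`. -/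
def qaoaAmplitude (N d : ℕ) (γ β : Fin d → ℝ) (x : BitString N) : ℂ :=
  qaoaUnitary N d γ β x (fun _ => false)

/-! ### Quantum circuits on qubits labelled by `ι` -/

/-- The gate set: arbitrary one-qubit gates, CNOT and Toffoli. -/
inductive Gate (ι : Type) : Type
  | single (q : ι) (A : Matrix.unitaryGroup Bool ℂ) : Gate ι
  | cnot (c t : ι) (hct : c ≠ t) : Gate ι
  | toffoli (a b t : ι) (hab : a ≠ b) (hat : a ≠ t) (hbt : b ≠ t) : Gate ι

/-- Pure states, as functions from computational basis labels to amplitudes. -/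
abbrev QState (ι : Type) : Type := (ι → Bool) → ℂ

/-- The action of a gate on a state. -/
def Gate.act {ι : Type} [DecidableEq ι] : Gate ι → QState ι → QState ι
  | .single q A, ψ => fun x => ∑ b : Bool, A.1 (x q) b * ψ (Function.update x q b)
  | .cnot c t _, ψ => fun x => ψ (Function.update x t (xor (x t) (x c)))
  | .toffoli a b t _ _ _, ψ => fun x => ψ (Function.update x t (xor (x t) (x a && x b)))

/-- The inverse gate. -/
def Gate.inverse {ι : Type} : Gate ι → Gate ι
  | .single q A => .single q A⁻¹
  | .cnot c t h => .cnot c t h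
  | .toffoli a b t hab hat hbt => .toffoli a b t hab hat hbt

/-- A circuit is the list of its gates, the first one being applied first; its number of gates is
the length of the list. -/
abbrev Circuit (ι : Type) : Type := List (Gate ι)

/-- The action of a circuit on a state. -/
def runCircuit {ι : Type} [DecidableEq ι] (c : Circuit ι) (ψ : QState ι) : QState ι :=
  c.foldl (fun φ g => g.act φ) ψ

/-- The inverse circuit. -/
def inverseCircuit {ι : Type} (c : Circuit ι) : Circuit ι := c.reverse.map Gate.inverse

/-- Computational basis states. -/
def ket {ι : Type} [Fintype ι] [DecidableEq ι] (x : ι → Bool) : QState ι := Pi.single x 1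

theorem sum_update {ι : Type} [Fintype ι] [DecidableEq ι] (q : ι) (f : (ι → Bool) → ℝ) :
    ∑ x : ι → Bool, ∑ b : Bool, f (Function.update x q b) = 2 * ∑ x : ι → Bool, f x := by
  have key : ∀ x : ι → Bool, ∑ b : Bool, f (Function.update x q b)
      = f x + f (Function.update x q (!(x q))) := by
    intro x
    have hx : Function.update x q (x q) = x := Function.update_eq_self q x
    rw [Fintype.sum_bool]
    cases h : x q
    · rw [h] at hx; simp [hx, add_comm]
    · rw [h] at hx; simp [hx]
  have hinv : Function.Involutive (fun x : ι → Bool => Function.update x q (!(x q))) := by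
    intro x; simp
  have hs := Equiv.sum_comp hinv.toPerm f
  simp only [Function.Involutive.coe_toPerm] at hs
  simp only [key, Finset.sum_add_distrib, hs]
  ring

theorem unitary_normSq (A : Matrix.unitaryGroup Bool ℂ) (v : Bool → ℂ) :
    ∑ b : Bool, ‖∑ b' : Bool, A.1 b b' * v b'‖ ^ 2 = ∑ b : Bool, ‖v b‖ ^ 2 := by
  have hA : star A.1 * A.1 = 1 := Matrix.mem_unitaryGroup_iff'.1 A.2
  have h : star (A.1.mulVec v) ⬝ᵥ (A.1.mulVec v) = star v ⬝ᵥ v := by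
    rw [Matrix.star_mulVec, Matrix.dotProduct_mulVec, Matrix.vecMul_vecMul,
      ← Matrix.star_eq_conjTranspose, hA, Matrix.vecMul_one]
  have conv : ∀ w : Bool → ℂ, star w ⬝ᵥ w = ((∑ b : Bool, ‖w b‖ ^ 2 : ℝ) : ℂ) := by
    intro w
    simp only [dotProduct, Pi.star_apply, Complex.ofReal_sum]
    refine Finset.sum_congr rfl fun b _ => ?_
    rw [RCLike.star_def, Complex.conj_mul']
    push_cast; rfl
  rw [conv, conv] at h
  exact_mod_cast h

theorem act_normSq {ι : Type} [Fintype ι] [DecidableEq ι] (g : Gate ι) (ψ : QState ι) :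
    ∑ x : ι → Bool, ‖g.act ψ x‖ ^ 2 = ∑ x : ι → Bool, ‖ψ x‖ ^ 2 := by
  cases g with
  | single q A =>
    have h1 := sum_update q fun x => ‖(Gate.single q A).act ψ x‖ ^ 2
    have h2 := sum_update q fun x => ‖ψ x‖ ^ 2
    have h3 : ∀ x : ι → Bool,
        ∑ b : Bool, ‖(Gate.single q A).act ψ (Function.update x q b)‖ ^ 2
          = ∑ b : Bool, ‖ψ (Function.update x q b)‖ ^ 2 := by
      intro x
      have := unitary_normSq A fun b => ψ (Function.update x q b)
      simpa only [Gate.act, Function.update_self, Function.update_idem] using this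
    simp only [h3] at h1
    linarith
  | cnot c t h =>
    have hinv : Function.Involutive
        (fun x : ι → Bool => Function.update x t (xor (x t) (x c))) := by
      intro x; simp [Function.update_of_ne h]
    have hs := Equiv.sum_comp hinv.toPerm fun x => ‖ψ x‖ ^ 2
    exact hs
  | toffoli a b t hab hat hbt =>
    have hinv : Function.Involutive
        (fun x : ι → Bool => Function.update x t (xor (x t) (x a && x b))) := by
      intro x; simp [Function.update_of_ne hat, Function.update_of_ne hbt]
    have hs := Equiv.sum_comp hinv.toPerm fun x => ‖ψ x‖ ^ 2
    exact hs

theorem runCircuit_normSq {ι : Type} [Fintype ι] [DecidableEq ι] (c : Circuit ι) (ψ : QState ι) :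
    ∑ x : ι → Bool, ‖runCircuit c ψ x‖ ^ 2 = ∑ x : ι → Bool, ‖ψ x‖ ^ 2 := by
  induction c generalizing ψ with
  | nil => rfl
  | cons g c ih => exact (ih (g.act ψ)).trans (act_normSq g ψ)

/-- Born's rule: the distribution of the outcome when all qubits are measured in the computational
basis after the circuit `c` has been applied to `|0…0⟩`. -/
def measureAll {ι : Type} [Fintype ι] [DecidableEq ι] (c : Circuit ι) : PMF (ι → Bool) :=
  PMF.ofFintype
    (fun x => ENNReal.ofReal (‖runCircuit c (ket fun _ => false) x‖ ^ 2)) (by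
      rw [← ENNReal.ofReal_sum_of_nonneg fun _ _ => by positivity, runCircuit_normSq,
        Finset.sum_eq_single (fun _ => false)]
      · simp [ket]
      · intro b _ hb; simp [ket, Pi.single_eq_of_ne hb]
      · simp)

/-! ### Circuits for the ingredients of the algorithm -/

/-- The basis state `|x⟩|y⟩` of a data register of `N` qubits and a work register. -/
def ket₂ {N w : ℕ} (x : BitString N) (y : BitString w) : QState (Fin N ⊕ Fin w) :=
  ket (Sum.elim x y)

/-- The number written in binary (least significant bit first) on the qubits `reg 0, reg 1, …`. -/
def binaryValue {w L : ℕ} (reg : Fin L ↪ Fin w) (y : BitString w) : ℕ :=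
  ∑ i : Fin L, if y (reg i) then 2 ^ (i : ℕ) else 0

/-- Circuits on `N` data qubits and some clean work qubits that implement the ingredients of
quantum minimum-finding with the state-preparation unitary `U`. -/
structure Implementation {N : ℕ} (U : Matrix (BitString N) (BitString N) ℂ) : Type where
  /-- number of work qubits -/
  work : ℕ
  /-- the circuit of the state-preparation unitary, `|x⟩|0⟩ ↦ (U|x⟩)|0⟩` -/
  prep : Circuit (Fin N ⊕ Fin work)
  prep_spec : ∀ x : BitString N, runCircuit prep (ket₂ x fun _ => false) =
    ∑ y : BitString N, U y x • ket₂ y fun _ => false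
  /-- the circuit that computes the energy in binary into a register,
  `|x⟩|0⟩ ↦ |x⟩|workAfter x⟩`; the work qubits outside the register may hold by-products -/
  cost : Circuit (Fin N ⊕ Fin work)
  regSize : ℕ
  reg : Fin regSize ↪ Fin work
  workAfter : BitString N → BitString work
  cost_spec : ∀ x : BitString N,
    runCircuit cost (ket₂ x fun _ => false) = ket₂ x (workAfter x)
  cost_value : ∀ x : BitString N, binaryValue reg (workAfter x) = energy x
  /-- for every threshold `s`, the circuit applied after `cost` that multiplies by `-1` when the
  energy is less than `s` -/
  compare : ℕ∞ → Circuit (Fin N ⊕ Fin work)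
  compare_spec : ∀ (s : ℕ∞) (x : BitString N), runCircuit (compare s) (ket₂ x (workAfter x)) =
    (if (energy x : ℕ∞) < s then (-1 : ℂ) else 1) • ket₂ x (workAfter x)
  /-- the reflection that multiplies `|0…0⟩` by `-1` and fixes the other basis states -/
  reflect : Circuit (Fin N ⊕ Fin work)
  reflect_spec : ∀ x : BitString N, runCircuit reflect (ket₂ x fun _ => false) =
    (if x = (fun _ => false) then (-1 : ℂ) else 1) • ket₂ x fun _ => false

namespace Implementation

variable {N : ℕ} {U : Matrix (BitString N) (BitString N) ℂ}

/-- The phase oracle of the marking function `m(x) = 1 ↔ energy x < s`. -/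
def oracle (I : Implementation U) (s : ℕ∞) : Circuit (Fin N ⊕ Fin I.work) :=
  I.cost ++ I.compare s ++ inverseCircuit I.cost

/-- One step of amplitude amplification for this marking function: the phase oracle, followed by
the reflection about `U|0…0⟩`. -/
def amplify (I : Implementation U) (s : ℕ∞) : Circuit (Fin N ⊕ Fin I.work) :=
  I.oracle s ++ inverseCircuit I.prep ++ I.reflect ++ I.prep

/-- One attempt of the search: prepare `U|0…0⟩`, do `j` steps of amplitude amplification, and
evaluate the energy of the result into the register. -/
def attempt (I : Implementation U) (s : ℕ∞) (j : ℕ) : Circuit (Fin N ⊕ Fin I.work) :=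
  I.prep ++ (List.replicate j (I.amplify s)).flatten ++ I.cost

/-- The number that is read off the energy register after a measurement. -/
def readValue (I : Implementation U) (c : Fin N ⊕ Fin I.work → Bool) : ℕ :=
  binaryValue I.reg fun i => c (Sum.inr i)

end Implementation

/-- The number of calls to `U`, to the energy circuit and to their inverses in one attempt with `j`
steps: four in each step, one call to `U` before and one call to the energy circuit after them. -/
def attemptCalls (j : ℕ) : ℕ := 4 * j + 2

/-! ### The algorithm -/

/-- A measured bitstring with its measured energy. -/
structure Sample (N : ℕ) : Type where
  bits : BitString N
  value : ℕ

/-- The threshold given by the last sample; it is `∞` before the first one. -/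
def threshold {N : ℕ} : Option (Sample N) → ℕ∞
  | none => ⊤
  | some a => (a.value : ℕ∞)

/-- What a search returns: a marked element (`none` if the calls have been used up before one was
found), the number of calls left, and the number of gates applied so far. -/
structure SearchResult (N : ℕ) : Type where
  found : Option (Sample N)
  callsLeft : ℕ
  gates : ℕ

/-- Number of attempts that exponential search with failure probability `ε` makes per scale. -/
def attemptsPerScale (ε : ℝ) : ℕ := ⌈3 * Real.logb 2 (1 / ε)⌉₊

/-- Exponential quantum search for an element of energy less than `s`, with failure probability `ε`.
For the scales `1, 2, 4, 8, …` in turn, make `attemptsPerScale ε` attempts, each with a number of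
amplification steps that is uniform below the scale; return the first marked outcome.
Here `t` attempts have been made already, `calls` calls are left, and `gates` gates have been
applied. The search is stopped when the next attempt would need more calls than are left. -/
def eqSearch {N : ℕ} {U : Matrix (BitString N) (BitString N) ℂ} (I : Implementation U) (s : ℕ∞)
    (ε : ℝ) (t calls gates : ℕ) : PMF (SearchResult N) :=
  (PMF.uniformOfFintype (Fin (2 ^ (t / attemptsPerScale ε)))).bind fun j =>
    if _h : attemptCalls j ≤ calls then
      (measureAll (I.attempt s j)).bind fun c =>
        if (I.readValue c : ℕ∞) < s then
          PMF.pure ⟨some ⟨fun i => c (Sum.inl i), I.readValue c⟩, calls - attemptCalls j,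
            gates + (I.attempt s j).length⟩
        else
          eqSearch I s ε (t + 1) (calls - attemptCalls j) (gates + (I.attempt s j).length)
    else
      PMF.pure ⟨none, calls, gates⟩
termination_by calls
decreasing_by
  have h1 : 0 < attemptCalls (j : ℕ) := by simp [attemptCalls]
  omega

/-- The outcome of a run: the output and the total number of gates applied. -/
structure RunResult (N : ℕ) : Type where
  output : Option (Sample N)
  gates : ℕ

/-- The inner loop: while calls are left, search for an element of energy less than that of the
last sample; the last sample is the result. Every completed search uses up at least one call, so
the number of iterations never exceeds the number of calls and `fuel` is set to the latter. -/
def innerLoop {N : ℕ} {U : Matrix (BitString N) (BitString N) ℂ} (I : Implementation U) (ε : ℝ) :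
    (fuel calls : ℕ) → (last : Option (Sample N)) → (gates : ℕ) → PMF (RunResult N)
  | 0, _, last, gates => PMF.pure ⟨last, gates⟩
  | fuel + 1, calls, last, gates =>
      (eqSearch I (threshold last) ε 0 calls gates).bind fun r =>
        match r.found with
        | some a => innerLoop I ε fuel r.callsLeft (some a) r.gates
        | none => PMF.pure ⟨last, r.gates⟩

/-- The sample of smaller energy. -/
def better {N : ℕ} (a b : Option (Sample N)) : Option (Sample N) :=
  if threshold b < threshold a then b else a

/-- `n` independent runs of the inner loop, each with at most `calls` calls; the output is the best
of the results. -/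
def repeatedMinFind {N : ℕ} {U : Matrix (BitString N) (BitString N) ℂ} (I : Implementation U)
    (ε : ℝ) (calls : ℕ) : (n : ℕ) → PMF (RunResult N)
  | 0 => PMF.pure ⟨none, 0⟩
  | n + 1 =>
      (repeatedMinFind I ε calls n).bind fun r =>
        (innerLoop I ε calls calls none 0).bind fun r' =>
          PMF.pure ⟨better r.output r'.output, r.gates + r'.gates⟩

/-- The number of repetitions of the inner loop, `⌈log₂ (1/δ)⌉`. -/
def repetitions (δ : ℝ) : ℕ := ⌈Real.logb 2 (1 / δ)⌉₊

/-- Generalized quantum minimum-finding with exponential quantum search as its subroutine and `U` as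
the state preparation: `⌈log₂ (1/δ)⌉` runs of the inner loop, each with at most `3 C M N` calls, and
searches with failure probability `1 / (6 * 2 ^ N)`. -/
def minimumFinding {N : ℕ} {U : Matrix (BitString N) (BitString N) ℂ} (I : Implementation U)
    (C M δ : ℝ) : PMF (RunResult N) :=
  repeatedMinFind I (1 / (6 * 2 ^ N)) ⌊3 * C * M * N⌋₊ (repetitions δ)

end LABS

end

/-! Amplification keeps the data state in the plane spanned by the marked and unmarked parts of |ψ⟩.
If the marked strings have probability P = sin²θ in |ψ⟩, then after j steps a measurement hits one
with probability sin²((2j+1)θ), and a hit has the law of |ψ⟩ conditioned on being marked, whatever j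
is. Averaged over j < m, the hit probability is at least 1/4 once m ≥ 1/√P
(`quarter_le_sum_sin_sq`). Hence a search with a ≥ 5 trials per scale makes O(a/√P) calls in
expectation (`exists_searchBound`). Only exhaustion of the budget ends a search without success, so
ε matters only through a = O(N).

Let P(s) be the probability of energy below s, and P₀ that of the minimum. If a search with
threshold s is charged w/√P(s), the potential w(2/√P₀ - 1/√P(s)) pays for it and for the mean
potential at the next threshold (`conditionalMean_loopBound_le`): the sum behind this is an upper
Riemann sum of ∫ dP/√P. So the minimum is reached within 2w/√P₀ = O(NM) expected calls, and Markov's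
inequality with the budget B = ⌊3CMN⌋ bounds the failure probability by 1/2. Markov is built into an
induction, in the form `B * Pr[failure] + calls ≤ B + (expected calls still needed)`
(`eqSearch_bind_bound`, `innerLoop_bound`), so expected call counts are never defined. Independent
runs multiply the failure probabilities.

For the gate count, the energy is an affine function of the number of odd terms among at most N³
products of four spins. A one-hot counter finds this number with polynomially many gates; phases and
comparisons are then one-qubit gates on its cells, and the binary value is written by CNOTs
(`qaoaImplementation`). With L bounding the total circuit size, gates plus L times the calls left
never increases. -/

noncomputable section

namespace LABS

/-! ### Linearity and inversion of circuits; gates on basis states. -/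

section Circuits

variable {ι : Type} [DecidableEq ι]

theorem act_sum_smul {α : Type} (g : Gate ι) (s : Finset α) (a : α → ℂ) (φ : α → QState ι) :
    g.act (∑ i ∈ s, a i • φ i) = ∑ i ∈ s, a i • g.act (φ i) := by
  cases g with
  | single q A =>
    funext x
    simp only [Gate.act, Finset.sum_apply, Pi.smul_apply, smul_eq_mul, Finset.mul_sum]
    rw [Finset.sum_comm]
    exact Finset.sum_congr rfl fun i _ => Finset.sum_congr rfl fun b _ => by ring
  | cnot c t h => funext x; simp [Gate.act, Finset.sum_apply]
  | toffoli a b t h1 h2 h3 => funext x; simp [Gate.act, Finset.sum_apply]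

@[simp] theorem runCircuit_nil (ψ : QState ι) : runCircuit [] ψ = ψ := rfl

@[simp] theorem runCircuit_cons (g : Gate ι) (c : Circuit ι) (ψ : QState ι) :
    runCircuit (g :: c) ψ = runCircuit c (g.act ψ) := rfl

theorem runCircuit_append (c c' : Circuit ι) (ψ : QState ι) :
    runCircuit (c ++ c') ψ = runCircuit c' (runCircuit c ψ) := List.foldl_append

theorem runCircuit_sum_smul {α : Type} (c : Circuit ι) (s : Finset α) (a : α → ℂ)
    (φ : α → QState ι) :
    runCircuit c (∑ i ∈ s, a i • φ i) = ∑ i ∈ s, a i • runCircuit c (φ i) := by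
  induction c generalizing φ with
  | nil => rfl
  | cons g c ih => simp only [runCircuit_cons, act_sum_smul, ih]

theorem runCircuit_smul (c : Circuit ι) (a : ℂ) (φ : QState ι) :
    runCircuit c (a • φ) = a • runCircuit c φ := by
  simpa using runCircuit_sum_smul c {()} (fun _ => a) (fun _ => φ)

theorem act_inverse_act (g : Gate ι) (ψ : QState ι) : g.inverse.act (g.act ψ) = ψ := by
  cases g with
  | single q A =>
    funext x
    have hA : A⁻¹.1 * A.1 = 1 := by
      rw [← Submonoid.coe_mul, inv_mul_cancel]; rfl
    have h2 : ∀ b', ∑ b, A⁻¹.1 (x q) b * A.1 b b' = (1 : Matrix Bool Bool ℂ) (x q) b' := by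
      intro b'; rw [← hA, Matrix.mul_apply]
    simp only [Gate.inverse, Gate.act, Function.update_self, Function.update_idem,
      Finset.mul_sum, ← mul_assoc]
    rw [Finset.sum_comm]
    simp only [← Finset.sum_mul, h2, Matrix.one_apply, ite_mul, one_mul, zero_mul,
      Finset.sum_ite_eq, Finset.mem_univ, if_true, Function.update_eq_self]
  | cnot c t h =>
    funext x
    simp [Gate.inverse, Gate.act, Function.update_of_ne h]
  | toffoli a b t h1 h2 h3 =>
    funext x
    simp [Gate.inverse, Gate.act, Function.update_of_ne h2, Function.update_of_ne h3]

theorem runCircuit_inverseCircuit (c : Circuit ι) (ψ : QState ι) :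
    runCircuit (inverseCircuit c) (runCircuit c ψ) = ψ := by
  induction c generalizing ψ with
  | nil => rfl
  | cons g c ih =>
    have : inverseCircuit (g :: c) = inverseCircuit c ++ [g.inverse] := by
      simp [inverseCircuit]
    rw [this, runCircuit_append, runCircuit_cons g c, ih]
    exact act_inverse_act g ψ

omit [DecidableEq ι] in
@[simp] theorem length_inverseCircuit (c : Circuit ι) :
    (inverseCircuit c).length = c.length := by
  simp [inverseCircuit]

variable [Fintype ι]

theorem ket_apply (z x : ι → Bool) : ket z x = if x = z then 1 else 0 := Pi.single_apply _ _ _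

theorem cnot_act_ket (c t : ι) (h : c ≠ t) (z : ι → Bool) :
    (Gate.cnot c t h).act (ket z) = ket (Function.update z t (xor (z t) (z c))) := by
  funext x
  simp only [Gate.act, ket_apply]
  congr 1
  apply propext
  constructor <;> rintro rfl <;> simp [Function.update_of_ne h]

theorem toffoli_act_ket (a b t : ι) (hab : a ≠ b) (hat : a ≠ t) (hbt : b ≠ t) (z : ι → Bool) :
    (Gate.toffoli a b t hab hat hbt).act (ket z)
      = ket (Function.update z t (xor (z t) (z a && z b))) := by
  funext x
  simp only [Gate.act, ket_apply]
  congr 1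
  apply propext
  constructor <;> rintro rfl <;> simp [Function.update_of_ne hat, Function.update_of_ne hbt]

/-- The bit flip. -/
def notGate : Matrix.unitaryGroup Bool ℂ :=
  ⟨Matrix.of fun b b' => if b = b' then 0 else 1, by
    rw [Matrix.mem_unitaryGroup_iff]
    ext b b'
    cases b <;> cases b' <;> simp [Matrix.mul_apply, Matrix.star_apply]⟩

theorem not_act_ket (q : ι) (z : ι → Bool) :
    (Gate.single q notGate).act (ket z) = ket (Function.update z q (!z q)) := by
  funext x
  have : ∀ b, Function.update x q b = z ↔ (b = z q ∧ ∀ i, i ≠ q → x i = z i) := by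
    intro b
    rw [funext_iff]
    constructor
    · intro h
      exact ⟨by simpa using h q, fun i hi => by simpa [hi] using h i⟩
    · rintro ⟨h1, h2⟩ i
      by_cases hi : i = q
      · subst hi; simpa using h1
      · simpa [hi] using h2 i hi
  have h' : x = Function.update z q (!z q) ↔ (x q = !z q) ∧ ∀ i, i ≠ q → x i = z i := by
    rw [Function.eq_update_iff]
  simp only [Gate.act, ket_apply, this, h', Fintype.sum_bool, notGate, Matrix.of_apply]
  cases x q <;> cases z q <;> simp

/-- The diagonal gate that multiplies `|1⟩` by `u`. -/
def phaseGate (u : Circle) : Matrix.unitaryGroup Bool ℂ :=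
  ⟨Matrix.diagonal fun b => if b then (u : ℂ) else 1, by
    rw [Matrix.mem_unitaryGroup_iff, Matrix.star_eq_conjTranspose, Matrix.diagonal_conjTranspose,
      Matrix.diagonal_mul_diagonal, ← Matrix.diagonal_one]
    congr 1
    funext b
    cases b <;> simp [Complex.mul_conj]⟩

theorem phase_act_ket (q : ι) (u : Circle) (z : ι → Bool) :
    (Gate.single q (phaseGate u)).act (ket z) = (if z q then (u : ℂ) else 1) • ket z := by
  funext x
  simp only [Gate.act, phaseGate, Matrix.diagonal_apply, ite_mul, zero_mul, Finset.sum_ite_eq,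
    Finset.mem_univ, if_true, Function.update_eq_self, ket_apply, Pi.smul_apply, smul_eq_mul]
  by_cases h : x = z
  · simp [h]
  · simp [h]

end Circuits

/-! ### Circuits that implement a matrix on the data register with clean work qubits. -/

section Implements

variable {N w : ℕ}

/-- The circuit maps `|x⟩|0⟩` to `(A|x⟩)|0⟩`. -/
def Implements (c : Circuit (Fin N ⊕ Fin w)) (A : Matrix (BitString N) (BitString N) ℂ) : Prop :=
  ∀ x : BitString N, runCircuit c (ket₂ x fun _ => false) = ∑ y, A y x • ket₂ y fun _ => false

theorem Implements.run {c : Circuit (Fin N ⊕ Fin w)} {A : Matrix (BitString N) (BitString N) ℂ}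
    (h : Implements c A) (v : BitString N → ℂ) :
    runCircuit c (∑ x, v x • ket₂ x fun _ => false)
      = ∑ y, (A.mulVec v) y • ket₂ y fun _ => false := by
  rw [runCircuit_sum_smul]
  simp only [h _, Finset.smul_sum, smul_smul, Matrix.mulVec, dotProduct, Finset.sum_smul]
  rw [Finset.sum_comm]
  exact Finset.sum_congr rfl fun i _ => Finset.sum_congr rfl fun b _ => by rw [mul_comm]

theorem Implements.append {c c' : Circuit (Fin N ⊕ Fin w)}
    {A B : Matrix (BitString N) (BitString N) ℂ}
    (h : Implements c A) (h' : Implements c' B) : Implements (c ++ c') (B * A) := by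
  intro x
  rw [runCircuit_append, h x, h'.run fun y => A y x]
  rfl

/-- Since `c` sends (B|x⟩)|0⟩ to (AB|x⟩)|0⟩ = |x⟩|0⟩, undoing `c` gives the claim; no matrix of the
inverse circuit is computed. -/
theorem Implements.inverse {c : Circuit (Fin N ⊕ Fin w)}
    {A B : Matrix (BitString N) (BitString N) ℂ}
    (h : Implements c A) (hAB : A * B = 1) : Implements (inverseCircuit c) B := by
  intro x
  have h1 : runCircuit c (∑ y, B y x • ket₂ y fun _ => false) = ket₂ x fun _ => false := by
    rw [h.run fun y => B y x]
    have : ∀ y, (A.mulVec fun y => B y x) y = if y = x then 1 else 0 := by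
      intro y
      have := congrFun (congrFun hAB y) x
      rwa [Matrix.one_apply] at this
    simp [this]
  rw [← h1, runCircuit_inverseCircuit]

theorem implements_diagonal {c : Circuit (Fin N ⊕ Fin w)} {f : BitString N → ℂ}
    (h : ∀ x, runCircuit c (ket₂ x fun _ => false) = f x • ket₂ x fun _ => false) :
    Implements c (Matrix.diagonal f) := by
  intro x
  rw [h, Finset.sum_eq_single x]
  · simp
  · intro y _ hy; simp [hy]
  · simp

theorem ket₂_apply (x : BitString N) (y : BitString w) (z : Fin N ⊕ Fin w → Bool) :
    ket₂ x y z = if (fun i => z (Sum.inl i)) = x ∧ (fun i => z (Sum.inr i)) = y then 1 else 0 := by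
  rw [ket₂, ket_apply]
  congr 1
  apply propext
  constructor
  · rintro rfl; simp
  · rintro ⟨rfl, rfl⟩; funext i; cases i <;> rfl

theorem sum_smul_ket₂_apply (v : BitString N → ℂ) (f : BitString N → BitString w)
    (z : Fin N ⊕ Fin w → Bool) :
    (∑ x, v x • ket₂ x (f x)) z
      = if (fun i => z (Sum.inr i)) = f (fun i => z (Sum.inl i))
        then v (fun i => z (Sum.inl i)) else 0 := by
  simp only [Finset.sum_apply, Pi.smul_apply, ket₂_apply, smul_eq_mul]
  rw [Finset.sum_eq_single (fun i => z (Sum.inl i))]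
  · simp
  · intro y _ hy; simp [Ne.symm hy]
  · simp

/-- The same one-qubit gate on every data qubit. -/
def layer (N w : ℕ) (A : Matrix.unitaryGroup Bool ℂ) : Circuit (Fin N ⊕ Fin w) :=
  (List.finRange N).map fun i => .single (Sum.inl i) A

/-- Each gate turns one factor of the tensor product from an identity entry into an entry of `A`;
induction removes the gate applied last. -/
theorem run_singles (A : Matrix.unitaryGroup Bool ℂ) (x : BitString N) (l : List (Fin N))
    (hl : l.Nodup) :
    runCircuit (l.map fun i => Gate.single (Sum.inl i) A) (ket₂ x fun _ : Fin w => false)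
      = ∑ y, (∏ i, if i ∈ l then A.1 (y i) (x i) else if y i = x i then 1 else 0) •
          ket₂ y fun _ => false := by
  induction l using List.reverseRecOn with
  | nil =>
    have h : ∀ y : BitString N, (∏ i, if y i = x i then (1 : ℂ) else 0) = if y = x then 1 else 0 := by
      intro y
      rw [Finset.prod_ite_zero]
      simp [funext_iff]
    simp [h]
  | append_singleton l q ih =>
    have hq : q ∉ l := by
      intro h; rw [List.nodup_append] at hl; exact hl.2.2 q h q (by simp) rfl
    rw [List.map_append, runCircuit_append, ih (List.nodup_append.1 hl).1]
    funext z
    simp only [List.map_cons, List.map_nil, runCircuit_cons, runCircuit_nil, Gate.act]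
    simp only [sum_smul_ket₂_apply (f := fun _ _ => false)]
    have e1 : ∀ b, (fun i => Function.update z (Sum.inl q) b (Sum.inr i)) = fun i => z (Sum.inr i) := by
      intro b; funext i; simp
    have e2 : ∀ b i, Function.update z (Sum.inl q) b (Sum.inl i)
        = Function.update (fun i => z (Sum.inl i)) q b i := by
      intro b i
      by_cases hi : i = q
      · subst hi; simp
      · simp [hi]
    simp only [e1, e2]
    by_cases hz : (fun i => z (Sum.inr i)) = fun _ => false
    · simp only [hz, if_true]
      -- Only the factor at `q` sees the update, and it is still an identity entry, so the sum over
      -- `b` collapses.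
      have e3 : ∀ b, (∏ i, if i ∈ l then A.1 (Function.update (fun i => z (Sum.inl i)) q b i) (x i)
            else if Function.update (fun i => z (Sum.inl i)) q b i = x i then (1 : ℂ) else 0)
          = (if b = x q then 1 else 0) * ∏ i ∈ Finset.univ.erase q,
            if i ∈ l ++ [q] then A.1 (z (Sum.inl i)) (x i)
            else if z (Sum.inl i) = x i then (1 : ℂ) else 0 := by
        intro b
        rw [← Finset.mul_prod_erase _ _ (Finset.mem_univ q)]
        congr 1
        · simp [hq]
        · refine Finset.prod_congr rfl fun i hi => ?_
          have hi' : i ≠ q := Finset.ne_of_mem_erase hi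
          simp [hi']
      simp only [e3]
      rw [← Finset.mul_prod_erase _ _ (Finset.mem_univ q)]
      simp
    · simp [hz]

theorem implements_layer (A : Matrix.unitaryGroup Bool ℂ) :
    Implements (layer N w A) (Matrix.of fun y x => ∏ i, A.1 (y i) (x i)) := by
  intro x
  rw [layer, run_singles A x _ (List.nodup_finRange N)]
  simp

end Implements

/-! ### A one-hot counter of odd-parity terms. -/

section Counter

variable {N K L : ℕ}

/-- Work register of the counting circuits: a parity bit, `K + 1` counter cells in one-hot encoding
(the counter is at `a`), and `L` further qubits. -/
def workState (K L : ℕ) (b : Bool) (a : ℕ) (f : ℕ → Bool) : BitString (K + L + 2) := fun n =>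
  if n.val = 0 then b else if n.val ≤ K + 1 then decide (n.val = a + 1) else f (n.val - (K + 2))

theorem toffoli_act_ket₂ {w : ℕ} (a b t : Fin w) 
    (hab' : (Sum.inr a : Fin N ⊕ Fin w) ≠ Sum.inr b) (hat' : (Sum.inr a : Fin N ⊕ Fin w) ≠ Sum.inr t)
    (hbt' : (Sum.inr b : Fin N ⊕ Fin w) ≠ Sum.inr t)
    (x : BitString N) (y : BitString w) :
    (Gate.toffoli (Sum.inr a) (Sum.inr b) (Sum.inr t) hab' hat' hbt').act (ket₂ x y)
      = ket₂ x (Function.update y t (xor (y t) (y a && y b))) := by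
  rw [ket₂, toffoli_act_ket, ket₂, Sum.update_elim_inr]
  simp only [Sum.elim_inr]

theorem cnot_act_ket₂ {w : ℕ} (a t : Fin w)
    (hat' : (Sum.inr a : Fin N ⊕ Fin w) ≠ Sum.inr t) (x : BitString N) (y : BitString w) :
    (Gate.cnot (Sum.inr a) (Sum.inr t) hat').act (ket₂ x y)
      = ket₂ x (Function.update y t (xor (y t) (y a))) := by
  rw [ket₂, cnot_act_ket, ket₂, Sum.update_elim_inr]
  simp only [Sum.elim_inr]

/-- The parity of the bits of `x` with indices in `l`. -/
def parity (x : BitString N) (l : List (Fin N)) : Bool := l.foldr (fun i b => xor (x i) b) false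

/-- Adds the parity of the data qubits in `l` to the parity bit. -/
def parityCircuit (K L : ℕ) (l : List (Fin N)) : Circuit (Fin N ⊕ Fin (K + L + 2)) :=
  l.map fun i => .cnot (Sum.inl i) (Sum.inr 0) Sum.inl_ne_inr

theorem run_parityCircuit (x : BitString N) (l : List (Fin N)) (b : Bool) (a : ℕ) (f : ℕ → Bool) :
    runCircuit (parityCircuit K L l) (ket₂ x (workState K L b a f))
      = ket₂ x (workState K L (xor b (parity x l)) a f) := by
  induction l generalizing b with
  | nil => simp [parityCircuit, parity]
  | cons i l ih =>
    have h : (Gate.cnot (Sum.inl i) (Sum.inr 0) Sum.inl_ne_inr).act (ket₂ x (workState K L b a f))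
        = ket₂ x (workState K L (xor b (x i)) a f) := by
      rw [ket₂, cnot_act_ket, ket₂, Sum.update_elim_inr]
      congr 2
      funext n
      by_cases hn : n = 0
      · subst hn
        simp only [workState, Function.update_self, Sum.elim_inr, Sum.elim_inl, Fin.val_zero,
          if_true]
      · have : n.val ≠ 0 := fun h => hn (Fin.ext h)
        simp only [workState, Function.update_of_ne hn, this, if_false]
    rw [parityCircuit, List.map_cons, runCircuit_cons, h]
    rw [parityCircuit] at ih
    rw [ih]
    simp [parity]

/-- If the parity bit is set, moves the counter from cell `c` to cell `c + 1`. -/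
def moveCell (N : ℕ) (K L : ℕ) (c : ℕ) (hc : c < K) : Circuit (Fin N ⊕ Fin (K + L + 2)) :=
  [.toffoli (Sum.inr 0) (Sum.inr ⟨c + 1, by omega⟩) (Sum.inr ⟨c + 2, by omega⟩)
      (by simp [Fin.ext_iff]) (by simp [Fin.ext_iff]) (by simp [Fin.ext_iff]),
    .toffoli (Sum.inr 0) (Sum.inr ⟨c + 2, by omega⟩) (Sum.inr ⟨c + 1, by omega⟩)
      (by simp [Fin.ext_iff]) (by simp [Fin.ext_iff]) (by simp [Fin.ext_iff])]

/-- With the parity bit set, the first Toffoli copies cell `c` to cell `c + 1` and the second clears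
cell `c`. A counter already at `c + 1` would make the second one light cell `c`; `h` excludes this.
Cell `c` sits at position `c + 1`, after the parity bit. -/
theorem run_moveCell (c : ℕ) (hc : c < K) (x : BitString N) (b : Bool) (a : ℕ) (f : ℕ → Bool)
    (h : b = false ∨ c + 1 ≠ a) :
    runCircuit (moveCell N K L c hc) (ket₂ x (workState K L b a f))
      = ket₂ x (workState K L b (if b = true ∧ c = a then a + 1 else a) f) := by
  rw [moveCell, runCircuit_cons, toffoli_act_ket₂, runCircuit_cons,
    toffoli_act_ket₂, runCircuit_nil]
  congr 1
  funext n
  have h1 : c + 1 ≤ K + 1 := by omega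
  have h2 : c + 2 ≤ K + 1 := by omega
  have h0 : c ≤ K := by omega
  simp only [Function.update_apply, Fin.ext_iff, workState, Fin.val_zero, if_true,
    Nat.add_eq_zero_iff, h1, h2]
  cases b
  · simp only [Bool.false_and, Bool.xor_false, Bool.false_eq_true, false_and, if_false]
    split_ifs <;> simp_all
  · have h3 : c + 1 ≠ a := by simpa using h
    by_cases h4 : c = a
    · subst h4
      by_cases h5 : n.val = c + 1
      · simp [h5, h0]
      · by_cases h6 : n.val = c + 2
        · simp [h6, hc]
        · by_cases h7 : n.val = 0
          · simp [h7]
          · simp [h5, h6, h7]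
    · by_cases h5 : n.val = c + 1
      · simp [h5, h4, h0, h3]
      · by_cases h6 : n.val = c + 2
        · simp [h6, h3, h4, hc]
        · by_cases h7 : n.val = 0
          · simp [h7]
          · simp [h5, h6, h7, h4]

/-- If the parity bit is set, moves the counter from any of the cells `0, …, k - 1` to the next. -/
def shiftCircuit (N : ℕ) (K L : ℕ) : (k : ℕ) → k ≤ K → Circuit (Fin N ⊕ Fin (K + L + 2))
  | 0, _ => []
  | k + 1, h => moveCell N K L k h ++ shiftCircuit N K L k (Nat.le_of_succ_le h)

/-- The cells are treated from the highest down, so a counter that has just moved is not moved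
again. -/
theorem run_shiftCircuit (k : ℕ) (hk : k ≤ K) (x : BitString N) (b : Bool) (a : ℕ) (f : ℕ → Bool)
    (h : b = false ∨ k ≠ a) :
    runCircuit (shiftCircuit N K L k hk) (ket₂ x (workState K L b a f))
      = ket₂ x (workState K L b (if b = true ∧ a < k then a + 1 else a) f) := by
  induction k generalizing a with
  | zero => simp [shiftCircuit]
  | succ k ih =>
    rw [shiftCircuit, runCircuit_append, run_moveCell _ _ _ _ _ _ h, ih]
    · congr 2; grind
    · grind

/-- Increments the counter if the parity of the data qubits in `l` is odd. -/
def countTerm (K L : ℕ) (l : List (Fin N)) : Circuit (Fin N ⊕ Fin (K + L + 2)) :=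
  parityCircuit K L l ++ shiftCircuit N K L K le_rfl ++ parityCircuit K L l

/-- The second parity circuit clears the parity bit for the next term; `ha` leaves room for one
increment. -/
theorem run_countTerm (l : List (Fin N)) (x : BitString N) (a : ℕ) (f : ℕ → Bool) (ha : a < K) :
    runCircuit (countTerm K L l) (ket₂ x (workState K L false a f))
      = ket₂ x (workState K L false (if parity x l then a + 1 else a) f) := by
  rw [countTerm, runCircuit_append, runCircuit_append, run_parityCircuit, run_shiftCircuit,
    run_parityCircuit]
  · simp [ha]
  · omega

/-- Counts the lists of data qubits of odd parity. -/
def countCircuit (K L : ℕ) (terms : List (List (Fin N))) : Circuit (Fin N ⊕ Fin (K + L + 2)) :=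
  .single (Sum.inr 1) notGate :: terms.flatMap (countTerm K L)

theorem run_flatMap_countTerm (terms : List (List (Fin N))) (x : BitString N) (a : ℕ)
    (f : ℕ → Bool) (ha : a + terms.length ≤ K) :
    runCircuit (terms.flatMap (countTerm K L)) (ket₂ x (workState K L false a f))
      = ket₂ x (workState K L false (a + terms.countP (parity x)) f) := by
  induction terms generalizing a with
  | nil => simp
  | cons l terms ih =>
    rw [List.length_cons] at ha
    rw [List.flatMap_cons, runCircuit_append, run_countTerm _ _ _ _ (by omega), ih,
      List.countP_cons]
    · congr 2
      split <;> omega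
    · split <;> omega

theorem run_countCircuit (terms : List (List (Fin N))) (hK : terms.length ≤ K) (x : BitString N) :
    runCircuit (countCircuit K L terms) (ket₂ x fun _ => false)
      = ket₂ x (workState K L false (terms.countP (parity x)) fun _ => false) := by
  have h : (Gate.single (Sum.inr 1) notGate).act (ket₂ x fun _ : Fin (K + L + 2) => false)
      = ket₂ x (workState K L false 0 fun _ => false) := by
    rw [ket₂, not_act_ket, ket₂, Sum.update_elim_inr]
    congr 2
    funext n
    simp only [Function.update_apply, Fin.ext_iff, workState]
    have : ((1 : Fin (K + L + 2)) : ℕ) = 1 := rfl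
    simp only [this]
    grind
  rw [countCircuit, runCircuit_cons, h, run_flatMap_countTerm _ _ _ _ (by omega), zero_add]

/-- Multiplies by `u a` if the counter is at `a`. -/
def cellPhases (N : ℕ) (K L : ℕ) (u : ℕ → Circle) : Circuit (Fin N ⊕ Fin (K + L + 2)) :=
  (List.finRange (K + 1)).map fun c : Fin (K + 1) =>
    .single (Sum.inr ⟨c.val + 1, by omega⟩) (phaseGate (u c))

theorem run_cellPhases (u : ℕ → Circle) (x : BitString N) (a : ℕ) (ha : a ≤ K) (b : Bool)
    (f : ℕ → Bool) :
    runCircuit (cellPhases N K L u) (ket₂ x (workState K L b a f))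
      = (u a : ℂ) • ket₂ x (workState K L b a f) := by
  have key : ∀ l : List (Fin (K + 1)),
      runCircuit (l.map fun c : Fin (K + 1) => Gate.single (Sum.inr ⟨c.val + 1, by omega⟩) (phaseGate (u c)))
        (ket₂ x (workState K L b a f))
      = (l.map fun c : Fin (K + 1) => if c.val = a then (u c : ℂ) else 1).prod •
          ket₂ x (workState K L b a f) := by
    intro l
    induction l with
    | nil => simp
    | cons c l ih =>
      have hc : workState K L b a f ⟨c + 1, by omega⟩ = decide (c.val = a) := by
        have := c.2
        simp only [workState]
        grind
      rw [List.map_cons, runCircuit_cons, ket₂, phase_act_ket, runCircuit_smul]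
      rw [ket₂] at ih
      rw [ih, smul_smul, List.map_cons, List.prod_cons]
      simp only [Sum.elim_inr, hc, decide_eq_true_eq]
  rw [cellPhases, key, ← List.ofFn_eq_map, List.prod_ofFn,
    Finset.prod_eq_single ⟨a, by omega⟩]
  · simp
  · intro c _ hc
    rw [if_neg]
    intro h; exact hc (Fin.ext h)
  · simp

/-- Multiplies by `u a` for the number `a` of odd terms, and leaves the work register clean. -/
def countPhases (K L : ℕ) (terms : List (List (Fin N))) (u : ℕ → Circle) :
    Circuit (Fin N ⊕ Fin (K + L + 2)) :=
  countCircuit K L terms ++ cellPhases N K L u ++ inverseCircuit (countCircuit K L terms)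

theorem run_countPhases (terms : List (List (Fin N))) (hK : terms.length ≤ K) (u : ℕ → Circle)
    (x : BitString N) :
    runCircuit (countPhases K L terms u) (ket₂ x fun _ => false)
      = (u (terms.countP (parity x)) : ℂ) • ket₂ x fun _ => false := by
  rw [countPhases, runCircuit_append, runCircuit_append, run_countCircuit _ hK,
    run_cellPhases _ _ _ (List.countP_le_length.trans hK), runCircuit_smul,
    ← run_countCircuit _ hK, runCircuit_inverseCircuit]

/-- The pairs of a counter value `a` and a register position at which `val a` has a binary digit
`1`. -/
def digitPairs (K L : ℕ) (val : ℕ → ℕ) : List (Fin (K + 1) × Fin L) :=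
  (List.finRange (K + 1) ×ˢ List.finRange L).filter fun q => (val q.1).testBit q.2

/-- Copies a counter cell to a register position. -/
def writeGate (N : ℕ) {K L : ℕ} (q : Fin (K + 1) × Fin L) : Gate (Fin N ⊕ Fin (K + L + 2)) :=
  .cnot (Sum.inr ⟨q.1.val + 1, by omega⟩) (Sum.inr ⟨K + 2 + q.2.val, by omega⟩)
    (by simp only [ne_eq, Sum.inr.injEq, Fin.mk.injEq]; omega)

/-- Writes `val a` into the register if the counter is at `a`. -/
def writeCircuit (N : ℕ) (K L : ℕ) (val : ℕ → ℕ) : Circuit (Fin N ⊕ Fin (K + L + 2)) :=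
  (digitPairs K L val).map (writeGate N)

/-- Digit `i` is flipped once for each gate from cell `a` to position `i`. The list of pairs has no
repetitions, so this happens once or never, according to `(val a).testBit i`. -/
theorem run_writeCircuit (val : ℕ → ℕ) (x : BitString N) (a : ℕ) (ha : a ≤ K) :
    runCircuit (writeCircuit N K L val) (ket₂ x (workState K L false a fun _ => false))
      = ket₂ x (workState K L false a (val a).testBit) := by
  have key : ∀ (l : List (Fin (K + 1) × Fin L)) (f : ℕ → Bool),
      runCircuit (l.map (writeGate N)) (ket₂ x (workState K L false a f))
      = ket₂ x (workState K L false a fun i =>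
          xor (f i) (decide (Odd (l.countP fun q => q.1.val = a ∧ q.2.val = i)))) := by
    intro l
    induction l with
    | nil => intro f; simp
    | cons q l ih =>
      intro f
      have h : (Function.update (workState K L false a f) ⟨K + 2 + q.2.val, by omega⟩
          (xor (workState K L false a f ⟨K + 2 + q.2.val, by omega⟩)
            (workState K L false a f ⟨q.1.val + 1, by omega⟩)))
          = workState K L false a fun i => xor (f i) (decide (q.1.val = a ∧ q.2.val = i)) := by
        funext n
        have h1 := q.1.2
        have h2 := q.2.2
        have h3 := n.2
        simp only [Function.update_apply, workState, Fin.ext_iff]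
        have e1 : K + 2 + q.2.val ≠ 0 := by omega
        have e2 : ¬ K + 2 + q.2.val ≤ K + 1 := by omega
        have e3 : q.1.val + 1 ≠ 0 := by omega
        have e4 : q.1.val + 1 ≤ K + 1 := by omega
        simp only [e1, e2, e3, e4, if_true, if_false, Nat.add_sub_cancel_left]
        by_cases hn : n.val = K + 2 + q.2
        · have e5 : n.val - (K + 2) = q.2 := by omega
          have e6 : n.val ≠ 0 := by omega
          have e7 : ¬ n.val ≤ K + 1 := by omega
          simp only [hn, e1, e2, if_true, if_false, and_true, Nat.add_sub_cancel_left]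
          congr 1
          simp
        · by_cases e7 : n.val ≤ K + 1
          · simp [hn, e7]
          · have e5 : q.2.val ≠ n.val - (K + 2) := by omega
            simp [hn, e7, e5]
      rw [List.map_cons, runCircuit_cons, writeGate, cnot_act_ket₂, h, ih]
      congr 2
      funext i
      rw [List.countP_cons, Bool.xor_assoc]
      congr 1
      by_cases hq : q.1.val = a ∧ q.2.val = i
      · simp only [hq, and_self, decide_true, if_true, Nat.odd_add_one, decide_not, decide_true]
        simp
      · simp [hq]
  rw [writeCircuit, key]
  congr 1
  funext n
  have hn := n.2
  simp only [workState]
  split_ifs with h1 h2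
  · rfl
  · rfl
  · have hi : n.val - (K + 2) < L := by omega
    generalize n.val - (K + 2) = i at hi
    have hc : ((digitPairs K L val).countP fun q => q.1.val = a ∧ q.2.val = i)
        = (digitPairs K L val).count (⟨a, by omega⟩, ⟨i, hi⟩) := by
      rw [List.count]
      congr 1
      funext q
      rw [Bool.eq_iff_iff]
      simp [Prod.ext_iff, Fin.ext_iff]
    have hnd : (digitPairs K L val).Nodup :=
      ((List.nodup_finRange _).product (List.nodup_finRange _)).filter _
    rw [hc]
    cases hb : (val a).testBit i
    · rw [List.count_eq_zero_of_not_mem]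
      · simp
      · simp [digitPairs, hb]
    · rw [List.count_eq_one_of_mem hnd]
      · simp
      · simp [digitPairs, hb]

theorem length_shiftCircuit (k : ℕ) (hk : k ≤ K) : (shiftCircuit N K L k hk).length = 2 * k := by
  induction k with
  | zero => rfl
  | succ k ih => rw [shiftCircuit, List.length_append, ih, moveCell]; simp; ring

theorem length_countTerm (l : List (Fin N)) :
    (countTerm K L l).length = 2 * l.length + 2 * K := by
  simp [countTerm, parityCircuit, length_shiftCircuit]; ring

theorem length_countCircuit_le (terms : List (List (Fin N))) (hK : terms.length ≤ K)
    (h4 : ∀ l ∈ terms, l.length ≤ 4) :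
    (countCircuit K L terms).length ≤ 1 + K * (8 + 2 * K) := by
  have : (terms.flatMap (countTerm K L)).length ≤ terms.length * (8 + 2 * K) := by
    rw [List.length_flatMap]
    have := List.sum_le_card_nsmul (terms.map fun l => (countTerm K L l).length) (8 + 2 * K) (by
      intro n hn
      obtain ⟨l, hl, rfl⟩ := List.mem_map.1 hn
      have := h4 l hl
      rw [length_countTerm]; omega)
    simpa using this
  have h2 : terms.length * (8 + 2 * K) ≤ K * (8 + 2 * K) := Nat.mul_le_mul_right _ hK
  rw [countCircuit, List.length_cons]
  omega

theorem length_cellPhases (u : ℕ → Circle) : (cellPhases N K L u).length = K + 1 := by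
  simp [cellPhases]

theorem length_writeCircuit_le (val : ℕ → ℕ) :
    (writeCircuit N K L val).length ≤ (K + 1) * L := by
  rw [writeCircuit, List.length_map, digitPairs]
  refine (List.length_filter_le _ _).trans ((List.length_product _ _).le.trans ?_)
  rw [List.length_finRange, List.length_finRange]

theorem length_countPhases_le (terms : List (List (Fin N))) (hK : terms.length ≤ K)
    (h4 : ∀ l ∈ terms, l.length ≤ 4) (u : ℕ → Circle) :
    (countPhases K L terms u).length ≤ 2 * (1 + K * (8 + 2 * K)) + (K + 1) := by
  have := length_countCircuit_le (L := L) terms hK h4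
  simp only [countPhases, List.length_append, length_inverseCircuit, length_cellPhases]
  omega

end Counter

/-! ### The energy as an affine function of the number of odd terms. -/

section Energy

variable {N : ℕ}

/-- The position `i + k`, or `i` if that is out of range. -/
def shiftIndex (i : Fin N) (k : ℕ) : Fin N := if h : (i : ℕ) + k < N then ⟨i + k, h⟩ else i

/-- The triples `(k, i, j)` of the products `s_i s_{i+k} s_j s_{j+k}` in the energy. -/
def energyIndices (N : ℕ) : Finset (Fin N × Fin N × Fin N) :=
  Finset.univ.filter fun q =>
    1 ≤ q.1.val ∧ q.2.1.val + q.1.val < N ∧ q.2.2.val + q.1.val < N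

/-- The products `s_i s_{i+k} s_j s_{j+k}` in the energy, as lists of positions. -/
def energyTerms (N : ℕ) : List (List (Fin N)) :=
  (energyIndices N).toList.map fun q =>
    [q.2.1, shiftIndex q.2.1 q.1, q.2.2, shiftIndex q.2.2 q.1]

theorem spin_mul_sign (x : BitString N) (i : Fin N) (b : Bool) :
    spin x i * (if b then -1 else 1) = if xor (x i) b then -1 else 1 := by
  cases h : x i <;> cases b <;> simp [spin, h]

theorem prod_spin (x : BitString N) (l : List (Fin N)) :
    (l.map (spin x)).prod = if parity x l then -1 else 1 := by
  induction l with
  | nil => simp [parity]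
  | cons i l ih =>
    rw [List.map_cons, List.prod_cons, ih, spin_mul_sign]
    rfl

theorem sum_sign_parity (x : BitString N) (terms : List (List (Fin N))) :
    (terms.map fun l => if parity x l then (-1 : ℤ) else 1).sum
      = terms.length - 2 * terms.countP (parity x) := by
  induction terms with
  | nil => simp
  | cons l terms ih =>
    rw [List.map_cons, List.sum_cons, ih, List.countP_cons, List.length_cons]
    cases parity x l <;> simp <;> ring

theorem energy_eq_sum (x : BitString N) :
    (energy x : ℤ) = ((energyTerms N).map fun l => (l.map (spin x)).prod).sum := by
  have h1 : ((energyTerms N).map fun l => (l.map (spin x)).prod).sum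
      = ∑ q ∈ energyIndices N, spin x q.2.1 * spin x (shiftIndex q.2.1 q.1) *
          (spin x q.2.2 * spin x (shiftIndex q.2.2 q.1)) := by
    rw [energyTerms, List.map_map, Finset.sum_map_toList]
    refine Finset.sum_congr rfl fun q _ => ?_
    simp [mul_assoc]
  have h2 : ∀ k : ℕ, autocorrelation x k
      = ∑ i : Fin N, if (i : ℕ) + k < N then spin x i * spin x (shiftIndex i k) else 0 := by
    intro k
    refine Finset.sum_congr rfl fun i _ => ?_
    by_cases h : (i : ℕ) + k < N <;> simp [h, shiftIndex]
  have h3 : (energy x : ℤ) = ∑ k : Fin N, if 1 ≤ k.val then autocorrelation x k ^ 2 else 0 := by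
    rw [energy, Nat.cast_sum, Fin.sum_univ_eq_sum_range
      (fun k => if 1 ≤ k then autocorrelation x k ^ 2 else 0), ← Finset.sum_filter]
    refine Finset.sum_congr ?_ fun k _ => by simp
    ext k
    simp only [Finset.mem_Icc, Finset.mem_filter, Finset.mem_range]
    omega
  rw [h1, h3, energyIndices, Finset.sum_filter, Fintype.sum_prod_type]
  refine Finset.sum_congr rfl fun k _ => ?_
  rw [Fintype.sum_prod_type]
  by_cases hk : 1 ≤ k.val
  · simp only [hk, if_true, true_and, h2, sq, Finset.sum_mul_sum]
    refine Finset.sum_congr rfl fun i _ => Finset.sum_congr rfl fun j _ => ?_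
    by_cases hi : (i : ℕ) + k < N <;> by_cases hj : (j : ℕ) + k < N <;> simp [hi, hj]
  · simp [hk]

/-- A product of spins is -1 exactly when its bits have odd parity, so each odd term lowers the sum
by 2. Repeated positions in a term cancel in the product and in the parity alike. -/
theorem energy_eq (x : BitString N) :
    energy x = (energyTerms N).length - 2 * (energyTerms N).countP (parity x) := by
  have h := energy_eq_sum x
  simp only [prod_spin, sum_sign_parity] at h
  omega

theorem length_energyTerms_le (N : ℕ) : (energyTerms N).length ≤ N ^ 3 := by
  rw [energyTerms, List.length_map, Finset.length_toList]
  refine (Finset.card_le_univ _).trans (le_of_eq ?_)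
  simp [pow_succ, mul_assoc]

theorem length_of_mem_energyTerms : ∀ l ∈ energyTerms N, l.length ≤ 4 := by
  intro l hl
  obtain ⟨q, -, rfl⟩ := List.mem_map.1 hl
  simp

/-- The single positions, as lists. -/
def bitTerms (N : ℕ) : List (List (Fin N)) := (List.finRange N).map fun i => [i]

theorem countP_bitTerms_eq_zero (x : BitString N) :
    (bitTerms N).countP (parity x) = 0 ↔ x = fun _ => false := by
  rw [List.countP_eq_zero, funext_iff]
  simp [bitTerms, parity]

end Energy

/-! ### Circuits for the QAOA unitary and the other ingredients, with polynomial size bounds. -/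

section ImplementationOfQAOA

open Polynomial

/-- The energy at the value `a` of the counter of odd terms. -/
def counterEnergy (N a : ℕ) : ℕ := (energyTerms N).length - 2 * a

/-- The unitary matrix `exp(-i β X)`. -/
def mixerGate (β : ℝ) : Matrix.unitaryGroup Bool ℂ :=
  ⟨Matrix.of fun b b' => if b = b' then (Real.cos β : ℂ) else -(Complex.I * (Real.sin β : ℂ)), by
    have h : (Real.cos β : ℂ) * Real.cos β + Real.sin β * Real.sin β = 1 := by
      rw [← sq, ← sq]
      exact_mod_cast Real.cos_sq_add_sin_sq β
    rw [Matrix.mem_unitaryGroup_iff]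
    ext b b'
    cases b <;> cases b' <;>
      simp only [Matrix.mul_apply, Matrix.star_apply, Matrix.of_apply, Fintype.sum_bool,
        Matrix.one_apply, RCLike.star_def, map_neg, map_mul, Complex.conj_I, Complex.conj_ofReal,
        if_true, Bool.false_eq_true, Bool.true_eq_false, if_false] <;>
      first
      | linear_combination h - (Real.sin β : ℂ) ^ 2 * Complex.I_sq
      | ring⟩

/-- The Hadamard gate. -/
def hadamardGate : Matrix.unitaryGroup Bool ℂ :=
  ⟨Matrix.of fun b b' => (((Real.sqrt 2)⁻¹ : ℝ) : ℂ) * (if b && b' then -1 else 1), by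
    have h : (((Real.sqrt 2)⁻¹ : ℝ) : ℂ) * (((Real.sqrt 2)⁻¹ : ℝ) : ℂ) = 1 / 2 := by
      have : (Real.sqrt 2)⁻¹ * (Real.sqrt 2)⁻¹ = 1 / 2 := by
        rw [← mul_inv, Real.mul_self_sqrt (by norm_num)]; norm_num
      rw [← Complex.ofReal_mul, this]; norm_num
    rw [Matrix.mem_unitaryGroup_iff]
    ext b b'
    cases b <;> cases b' <;>
      simp only [Matrix.mul_apply, Matrix.star_apply, Matrix.of_apply, Fintype.sum_bool,
        Matrix.one_apply, RCLike.star_def, map_mul, Complex.conj_ofReal,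
        Bool.and_true, Bool.and_false, Bool.false_eq_true, if_true, if_false, map_neg, map_one,
        reduceCtorEq, mul_one, mul_neg, neg_mul, neg_neg, h] <;> norm_num⟩

theorem implements_hadamard {N w : ℕ} : Implements (layer N w hadamardGate) (hadamardAll N) :=
  implements_layer hadamardGate

theorem implements_mixer {N w : ℕ} (β : ℝ) :
    Implements (layer N w (mixerGate β)) (mixer N β) :=
  implements_layer (mixerGate β)

/-- The phases `exp(-i γ E)` for the counter of odd terms. -/
def energyPhase (N : ℕ) (γ : ℝ) (a : ℕ) : Circle := Circle.exp (-(γ * counterEnergy N a))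

theorem implements_phase {N K L : ℕ} (hK : (energyTerms N).length ≤ K) (γ : ℝ) :
    Implements (countPhases K L (energyTerms N) (energyPhase N γ)) (phaseOperator N γ) := by
  refine implements_diagonal fun x => ?_
  rw [run_countPhases _ hK]
  congr 1
  rw [energyPhase, counterEnergy, ← energy_eq, Circle.coe_exp]
  congr 1
  push_cast
  ring

/-- The circuit of the QAOA unitary. -/
def qaoaCircuit (N K L : ℕ) : (d : ℕ) → (γ β : Fin d → ℝ) → Circuit (Fin N ⊕ Fin (K + L + 2))
  | 0, _, _ => layer N _ hadamardGate
  | d + 1, γ, β =>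
      qaoaCircuit N K L d (fun i => γ i.castSucc) (fun i => β i.castSucc) ++
        countPhases K L (energyTerms N) (energyPhase N (γ (Fin.last d))) ++
        layer N _ (mixerGate (β (Fin.last d)))

theorem implements_qaoaCircuit {N K L : ℕ} (hK : (energyTerms N).length ≤ K) (d : ℕ)
    (γ β : Fin d → ℝ) : Implements (qaoaCircuit N K L d γ β) (qaoaUnitary N d γ β) := by
  induction d with
  | zero => exact implements_hadamard
  | succ d ih =>
    rw [qaoaCircuit, qaoaUnitary, Matrix.mul_assoc]
    exact ((ih _ _).append (implements_phase hK _)).append (implements_mixer _)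

theorem length_qaoaCircuit_le {N K L : ℕ} (hK : (energyTerms N).length ≤ K) (d : ℕ)
    (γ β : Fin d → ℝ) :
    (qaoaCircuit N K L d γ β).length
      ≤ N + d * (N + (2 * (1 + K * (8 + 2 * K)) + (K + 1))) := by
  induction d with
  | zero => simp [qaoaCircuit, layer]
  | succ d ih =>
    have h1 := ih (fun i => γ i.castSucc) (fun i => β i.castSucc)
    have h2 := length_countPhases_le (L := L) (energyTerms N) hK length_of_mem_energyTerms
      (energyPhase N (γ (Fin.last d)))
    rw [qaoaCircuit, List.length_append, List.length_append, layer, List.length_map,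
      List.length_finRange, Nat.succ_mul]
    omega

/-- The work register after the energy has been computed. -/
def energyWork (N : ℕ) (x : BitString N) : BitString (N ^ 3 + N ^ 3 + 2) :=
  workState (N ^ 3) (N ^ 3) false ((energyTerms N).countP (parity x)) (energy x).testBit

/-- The positions of the binary digits of the energy in the work register. -/
def energyRegister (N : ℕ) : Fin (N ^ 3) ↪ Fin (N ^ 3 + N ^ 3 + 2) where
  toFun i := ⟨N ^ 3 + 2 + i, by omega⟩
  inj' i j h := by
    have := congrArg Fin.val h
    exact Fin.ext (by simpa using this)

theorem energyWork_energyRegister (N : ℕ) (x : BitString N) (i : Fin (N ^ 3)) :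
    energyWork N x (energyRegister N i) = (energy x).testBit i := by
  have h1 : N ^ 3 + 2 + i.val ≠ 0 := by omega
  have h2 : ¬ N ^ 3 + 2 + i.val ≤ N ^ 3 + 1 := by omega
  have h3 : (energyRegister N i).val = N ^ 3 + 2 + i.val := rfl
  simp only [energyWork, workState, h1, h2, h3, if_false, Nat.add_sub_cancel_left]

/-- `-1` for the counter values at which the energy is less than `s`. -/
def comparePhase (N : ℕ) (s : ℕ∞) (a : ℕ) : Circle :=
  if (counterEnergy N a : ℕ∞) < s then -1 else 1

/-- `-1` at zero. -/
def zeroPhase (a : ℕ) : Circle := if a = 0 then -1 else 1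

/-- A crude bound that lets `N ^ 3` serve both as counter capacity and as register length. -/
theorem energy_lt (N : ℕ) (x : BitString N) : energy x < 2 ^ N ^ 3 :=
  calc energy x ≤ (energyTerms N).length := by rw [energy_eq]; omega
    _ ≤ N ^ 3 := length_energyTerms_le N
    _ < 2 ^ N ^ 3 := Nat.lt_two_pow_self

theorem sum_testBit (n L : ℕ) (h : n < 2 ^ L) :
    ∑ i : Fin L, (if n.testBit i then 2 ^ (i : ℕ) else 0) = n := by
  rw [Fin.sum_univ_eq_sum_range fun i => if n.testBit i then 2 ^ i else 0]
  induction L generalizing n with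
  | zero => simp at h; simp [h]
  | succ L ih =>
    rw [Finset.sum_range_succ', Nat.testBit_zero]
    have h1 := ih (n / 2) (by rw [pow_succ] at h; omega)
    have h2 : ∀ i, (if n.testBit (i + 1) then 2 ^ (i + 1) else 0)
        = 2 * if (n / 2).testBit i then 2 ^ i else 0 := by
      intro i
      rw [Nat.testBit_succ]
      split <;> ring
    simp only [h2, ← Finset.mul_sum, h1, decide_eq_true_eq, pow_zero]
    split <;> omega

/-- The circuits of the ingredients of minimum-finding with the QAOA state preparation. -/
def qaoaImplementation (N d : ℕ) (γ β : Fin d → ℝ) : Implementation (qaoaUnitary N d γ β) where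
  work := N ^ 3 + N ^ 3 + 2
  prep := qaoaCircuit N (N ^ 3) (N ^ 3) d γ β
  prep_spec := implements_qaoaCircuit (length_energyTerms_le N) d γ β
  cost := countCircuit (N ^ 3) (N ^ 3) (energyTerms N) ++
    writeCircuit N (N ^ 3) (N ^ 3) (counterEnergy N)
  regSize := N ^ 3
  reg := energyRegister N
  workAfter := energyWork N
  cost_spec x := by
    rw [runCircuit_append, run_countCircuit _ (length_energyTerms_le N), run_writeCircuit _ _ _
      (List.countP_le_length.trans (length_energyTerms_le N)), counterEnergy, ← energy_eq]
    rfl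
  cost_value x := by
    refine (Finset.sum_congr rfl fun i _ => ?_).trans (sum_testBit _ _ (energy_lt N x))
    rw [energyWork_energyRegister]
  -- `cost` leaves the counter in place, so the comparison is a table of signs on its cells, without
  -- arithmetic on the binary register.
  compare s := cellPhases N (N ^ 3) (N ^ 3) (comparePhase N s)
  compare_spec s x := by
    rw [energyWork, run_cellPhases _ _ _
      (List.countP_le_length.trans (length_energyTerms_le N)), comparePhase, counterEnergy,
      ← energy_eq]
    split <;> simp
  -- The same counter computes the Hamming weight, and the sign is put on weight 0.
  reflect := countPhases (N ^ 3) (N ^ 3) (bitTerms N) zeroPhase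
  reflect_spec x := by
    have hN : (bitTerms N).length ≤ N ^ 3 := by
      simpa [bitTerms] using Nat.le_self_pow (by norm_num) N
    rw [run_countPhases _ hN]
    congr 1
    simp only [zeroPhase, countP_bitTerms_eq_zero]
    split <;> simp

/-- The circuits of the ingredients have at most `n` gates in total, for every threshold. -/
def Implementation.SizeLE {N : ℕ} {U : Matrix (BitString N) (BitString N) ℂ} (I : Implementation U)
    (n : ℕ) : Prop :=
  ∀ s, I.prep.length + I.cost.length + (I.compare s).length + I.reflect.length ≤ n

/-- A bound on the total size of the circuits. -/
def sizePolynomial (d : ℕ) : Polynomial ℕ :=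
  (X + C d * (X + (2 * (1 + X ^ 3 * (8 + 2 * X ^ 3)) + (X ^ 3 + 1)))) +
    ((1 + X ^ 3 * (8 + 2 * X ^ 3)) + (X ^ 3 + 1) * X ^ 3) + (X ^ 3 + 1) +
    (2 * (1 + X ^ 3 * (8 + 2 * X ^ 3)) + (X ^ 3 + 1))

theorem sizeLE_qaoaImplementation (N d : ℕ) (γ β : Fin d → ℝ) :
    (qaoaImplementation N d γ β).SizeLE ((sizePolynomial d).eval N) := by
  intro s
  have hN : (bitTerms N).length ≤ N ^ 3 := by
    simpa [bitTerms] using Nat.le_self_pow (by norm_num) N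
  have h1 := length_qaoaCircuit_le (L := N ^ 3) (length_energyTerms_le N) d γ β
  have h2 := length_countCircuit_le (L := N ^ 3) _ (length_energyTerms_le N)
    length_of_mem_energyTerms
  have h3 := length_writeCircuit_le (N := N) (K := N ^ 3) (L := N ^ 3) (counterEnergy N)
  have h4 := length_countPhases_le (L := N ^ 3) _ hN (by simp [bitTerms]) zeroPhase
  have h5 := length_cellPhases (N := N) (K := N ^ 3) (L := N ^ 3) (comparePhase N s)
  simp only [qaoaImplementation, List.length_append, sizePolynomial, eval_add, eval_mul, eval_X,
    eval_C, eval_pow, eval_ofNat, eval_one]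
  omega

end ImplementationOfQAOA

/-! ### Average success probability over a uniform number of amplification steps. -/

section SineSums

open Real

/-- The sum telescopes: 4mθ and 4(m+1)θ are 2x - 2θ and 2x + 2θ for x = (2m+1)θ. -/
theorem sum_sin_sq (θ : ℝ) (m : ℕ) :
    4 * sin (2 * θ) * ∑ j ∈ Finset.range m, sin ((2 * j + 1) * θ) ^ 2
      = 2 * m * sin (2 * θ) - sin (4 * m * θ) := by
  induction m with
  | zero => simp
  | succ m ih =>
    rw [Finset.sum_range_succ, mul_add, ih]
    have e1 : 4 * ((m + 1 : ℕ) : ℝ) * θ = 2 * ((2 * m + 1) * θ) + 2 * θ := by push_cast; ring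
    have e2 : 4 * (m : ℝ) * θ = 2 * ((2 * m + 1) * θ) - 2 * θ := by ring
    rw [e1, e2, sin_add, sin_sub, cos_two_mul ((2 * m + 1) * θ)]
    push_cast
    linear_combination 4 * sin (2 * θ) * sin_sq_add_cos_sq ((2 * m + 1) * θ)

/-- When sin 2θ > 0, `sum_sin_sq` reduces the claim to sin(4mθ) ≤ m sin 2θ (`key`), which is clear
as soon as m sin 2θ ≥ 1. -/
theorem quarter_le_sum_sin_sq {P : ℝ} (hP : 0 < P) (hP1 : P ≤ 1) (m : ℕ) (hm : 1 ≤ m * √P) :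
    (m : ℝ) / 4 ≤ ∑ j ∈ Finset.range m, sin ((2 * j + 1) * arcsin √P) ^ 2 := by
  set θ := arcsin √P with hθ
  have hs0 : 0 < √P := sqrt_pos.2 hP
  have hs1 : √P ≤ 1 := sqrt_le_one.2 hP1
  have hsq : √P ^ 2 = P := sq_sqrt hP.le
  have hm0 : (0 : ℝ) ≤ m := Nat.cast_nonneg m
  have hsin : sin θ = √P := sin_arcsin (by linarith) hs1
  have hθ0 : 0 < θ := arcsin_pos.2 hs0
  have hθ1 : θ ≤ π / 2 := arcsin_le_pi_div_two _
  have hcos : 0 ≤ cos θ := cos_nonneg_of_mem_Icc ⟨by linarith, hθ1⟩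
  have hcsq : cos θ ^ 2 = 1 - P := by rw [cos_sq', hsin, hsq]
  have key : 0 < sin (2 * θ) → sin (4 * m * θ) ≤ m * sin (2 * θ) →
      (m : ℝ) / 4 ≤ ∑ j ∈ Finset.range m, sin ((2 * j + 1) * θ) ^ 2 := by
    intro h1 h2
    have h3 := sum_sin_sq θ m
    have h4 : m * sin (2 * θ) ≤ (4 * ∑ j ∈ Finset.range m, sin ((2 * j + 1) * θ) ^ 2) *
        sin (2 * θ) := by linarith
    have := le_of_mul_le_mul_right h4 h1
    linarith
  rcases le_or_gt P (1 / 2) with hP2 | hP2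
  -- Here sin 2θ = 2√P cos θ ≥ √P, hence m sin 2θ ≥ m√P ≥ 1.
  · have hc : 1 / 2 ≤ cos θ := by
      by_contra h
      push Not at h
      nlinarith
    have hS : √P ≤ sin (2 * θ) := by
      rw [sin_two_mul, hsin]; nlinarith
    refine key (hs0.trans_le hS) ((sin_le_one _).trans (hm.trans ?_))
    exact mul_le_mul_of_nonneg_left hS hm0
  -- For θ = π/2, `key` does not apply because sin 2θ = 0, but every summand is 1.
  · rcases eq_or_lt_of_le hθ1 with h | h
    · have h1 : ∀ j : ℕ, sin ((2 * j + 1) * θ) ^ 2 = 1 := by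
        intro j
        have : cos ((2 * j + 1) * θ) = 0 := by
          rw [cos_eq_zero_iff]
          exact ⟨j, by rw [h]; push_cast; ring⟩
        rw [sin_sq, this]; norm_num
      simp only [h1, Finset.sum_const, Finset.card_range, nsmul_eq_mul, mul_one]
      linarith
    · set φ := π / 2 - θ with hφ
      have hφ0 : 0 < φ := by linarith
      have hφ1 : φ ≤ π / 4 := by
        by_contra h'
        push Not at h'
        have h2 : 0 < cos (2 * θ) := cos_pos_of_mem_Ioo ⟨by linarith, by linarith⟩
        rw [cos_two_mul, hcsq] at h2
        linarith
      have e1 : sin (2 * θ) = sin (2 * φ) := by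
        rw [← sin_pi_sub]; congr 1; rw [hφ]; ring
      have e2 : sin (4 * m * θ) = - sin (4 * m * φ) := by
        have : 4 * m * θ = (m : ℕ) * (2 * π) - 4 * m * φ := by rw [hφ]; ring
        rw [this, sin_nat_mul_two_pi_sub]
      have hj := mul_le_sin (x := 2 * φ) (by linarith) (by linarith)
      have hpos : 0 < sin (2 * φ) := sin_pos_of_pos_of_lt_pi (by linarith) (by linarith)
      refine key (e1 ▸ hpos) ?_
      rw [e1, e2]
      -- As sin(4mθ) = -sin(4mφ), either 4mφ ≤ π and the left side is nonpositive, or Jordan's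
      -- inequality gives m sin 2φ ≥ 4mφ/π ≥ 1.
      rcases le_or_gt (4 * m * φ) π with h4 | h4
      · have := sin_nonneg_of_nonneg_of_le_pi (x := 4 * m * φ) (by positivity) h4
        have := mul_nonneg hm0 hpos.le
        linarith
      · have h5 : 1 ≤ m * sin (2 * φ) := by
          have h6 : 1 ≤ m * (2 / π * (2 * φ)) := by
            rw [show m * (2 / π * (2 * φ)) = 4 * m * φ / π by ring, le_div_iff₀ pi_pos]
            linarith
          exact h6.trans (mul_le_mul_of_nonneg_left hj hm0)
        have := neg_one_le_sin (4 * m * φ)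
        linarith

end SineSums

/-! ### The state and the measured outcome after `j` steps of amplitude amplification. -/

section Amplification

open Real

/-- The factors of the marked and of the unmarked amplitudes after `j` steps of amplitude
amplification, when the marked states have probability `P`. -/
def ampCoeff (P : ℝ) : ℕ → ℝ × ℝ
  | 0 => (1, 1)
  | j + 1 =>
    let a := (ampCoeff P j).1
    let b := (ampCoeff P j).2
    (-a - 2 * (-a * P + b * (1 - P)), b - 2 * (-a * P + b * (1 - P)))

/-- A step is a rotation by 2θ up to the sign -1, because the second reflection is 1 - 2|ψ⟩⟨ψ| and
not its negative. -/
theorem ampCoeff_sq_mul {P : ℝ} (hP : 0 ≤ P) (hP1 : P ≤ 1) (j : ℕ) :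
    (ampCoeff P j).1 ^ 2 * P = sin ((2 * j + 1) * arcsin √P) ^ 2 := by
  set θ := arcsin √P with hθ
  have hs1 : √P ≤ 1 := sqrt_le_one.2 hP1
  have hsin : sin θ = √P := sin_arcsin (by linarith [sqrt_nonneg P]) hs1
  have hsq : sin θ ^ 2 = P := by rw [hsin, sq_sqrt hP]
  have hcsq : cos θ ^ 2 = 1 - P := by rw [cos_sq', hsq]
  -- The factors sin θ and cos θ stay on the left, so that P = 0 and P = 1 need no separate
  -- treatment.
  have key : ∀ j : ℕ, (ampCoeff P j).1 * sin θ = (-1) ^ j * sin ((2 * j + 1) * θ) ∧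
      (ampCoeff P j).2 * cos θ = (-1) ^ j * cos ((2 * j + 1) * θ) := by
    intro j
    induction j with
    | zero => simp [ampCoeff]
    | succ j ih =>
      obtain ⟨h1, h2⟩ := ih
      have e : (2 * ((j + 1 : ℕ) : ℝ) + 1) * θ = (2 * j + 1) * θ + 2 * θ := by push_cast; ring
      rw [e, sin_add, cos_add, sin_two_mul, cos_two_mul, pow_succ]
      simp only [ampCoeff]
      rw [← hcsq]
      have hP' : P = 1 - cos θ ^ 2 := by linarith
      have hss : sin θ ^ 2 = 1 - cos θ ^ 2 := by linarith
      constructor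
      · linear_combination (1 - 2 * cos θ ^ 2) * h1 - 2 * sin θ * cos θ * h2
          + 2 * (ampCoeff P j).1 * sin θ * hP'
      · linear_combination (1 - 2 * cos θ ^ 2) * h2 + 2 * sin θ * cos θ * h1
          + 2 * (ampCoeff P j).1 * cos θ * (hP' - hss)
  have h := (key j).1
  have h2 : ((-1 : ℝ) ^ j) ^ 2 = 1 := by rw [← pow_mul, mul_comm, pow_mul]; norm_num
  calc (ampCoeff P j).1 ^ 2 * P = ((ampCoeff P j).1 * sin θ) ^ 2 := by rw [mul_pow, hsq]
    _ = _ := by rw [h, mul_pow, h2, one_mul]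

theorem sum_normSq_smul_ket₂_mul {N w : ℕ} (v : BitString N → ℂ) (f : BitString N → BitString w)
    (g : (Fin N ⊕ Fin w → Bool) → ℝ) :
    ∑ z, ‖(∑ x, v x • ket₂ x (f x)) z‖ ^ 2 * g z = ∑ x, ‖v x‖ ^ 2 * g (Sum.elim x (f x)) := by
  rw [← Equiv.sum_comp (Equiv.sumArrowEquivProdArrow (Fin N) (Fin w) Bool).symm,
    Fintype.sum_prod_type]
  refine Finset.sum_congr rfl fun x _ => ?_
  simp only [sum_smul_ket₂_apply]
  rw [Finset.sum_eq_single (f x)]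
  · simp [Equiv.sumArrowEquivProdArrow]
  · intro y _ hy
    simp [Equiv.sumArrowEquivProdArrow, hy]
  · simp

theorem conjTranspose_mul_self_of_isometry {n : Type} [Fintype n] [DecidableEq n]
    (U : Matrix n n ℂ) (h : ∀ v : n → ℂ, ∑ x, ‖(U.mulVec v) x‖ ^ 2 = ∑ x, ‖v x‖ ^ 2) :
    U.conjTranspose * U = 1 := by
  let T : EuclideanSpace ℂ n →ₗᵢ[ℂ] EuclideanSpace ℂ n :=
    ⟨Matrix.toEuclideanLin U, fun v => by
      rw [EuclideanSpace.norm_eq, EuclideanSpace.norm_eq]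
      congr 1
      exact h v.ofLp⟩
  ext i j
  have := T.inner_map_map (EuclideanSpace.single i 1) (EuclideanSpace.single j 1)
  simp only [EuclideanSpace.inner_single_left, map_one, one_mul, PiLp.single_apply] at this
  rw [Matrix.one_apply, ← this, Matrix.mul_apply, PiLp.inner_apply]
  refine Finset.sum_congr rfl fun k _ => ?_
  simp [T, Matrix.toLpLin_apply, mul_comm]

namespace Implementation

variable {N : ℕ} {U : Matrix (BitString N) (BitString N) ℂ}

/-- Gates preserve the norm, so a matrix implemented by a circuit is unitary; nothing specific to
QAOA is needed. -/
theorem conjTranspose_mul_self (I : Implementation U) : U.conjTranspose * U = 1 := by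
  refine conjTranspose_mul_self_of_isometry U fun v => ?_
  have h : Implements I.prep U := I.prep_spec
  have h1 := sum_normSq_smul_ket₂_mul v (fun _ _ => false : BitString N → BitString I.work) 1
  have h2 := sum_normSq_smul_ket₂_mul (U.mulVec v)
    (fun _ _ => false : BitString N → BitString I.work) 1
  simp only [Pi.one_apply, mul_one] at h1 h2
  rw [← h1, ← h2, ← h.run, runCircuit_normSq]

theorem mul_conjTranspose_self (I : Implementation U) : U * U.conjTranspose = 1 :=
  mul_eq_one_comm.1 I.conjTranspose_mul_self

theorem sum_normSq (I : Implementation U) : ∑ x, ‖U x fun _ => false‖ ^ 2 = 1 := by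
  have h := congrFun (congrFun I.conjTranspose_mul_self fun _ => false) fun _ => false
  rw [Matrix.mul_apply, Matrix.one_apply_eq] at h
  simp only [Matrix.conjTranspose_apply, RCLike.star_def, Complex.conj_mul'] at h
  exact_mod_cast h

end Implementation

/-- The probability that the state `U|0…0⟩` has energy less than `s`. -/
def markedProb {N : ℕ} (U : Matrix (BitString N) (BitString N) ℂ) (s : ℕ∞) : ℝ :=
  ∑ x, if (energy x : ℕ∞) < s then ‖U x fun _ => false‖ ^ 2 else 0

/-- The data amplitudes after `j` steps of amplitude amplification. -/
def amplified {N : ℕ} (U : Matrix (BitString N) (BitString N) ℂ) (s : ℕ∞) (j : ℕ)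
    (x : BitString N) : ℂ :=
  (((if (energy x : ℕ∞) < s then (ampCoeff (markedProb U s) j).1
    else (ampCoeff (markedProb U s) j).2 : ℝ)) : ℂ) * U x fun _ => false

theorem markedProb_nonneg {N : ℕ} (U : Matrix (BitString N) (BitString N) ℂ) (s : ℕ∞) :
    0 ≤ markedProb U s :=
  Finset.sum_nonneg fun _ _ => by split <;> positivity

namespace Implementation

variable {N : ℕ} {U : Matrix (BitString N) (BitString N) ℂ}

theorem markedProb_le_one (I : Implementation U) (s : ℕ∞) : markedProb U s ≤ 1 := by
  rw [← I.sum_normSq]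
  refine Finset.sum_le_sum fun x _ => ?_
  split
  · exact le_rfl
  · positivity

/-- The matrix of a step of amplitude amplification. -/
def amplifyMatrix (U : Matrix (BitString N) (BitString N) ℂ) (s : ℕ∞) :
    Matrix (BitString N) (BitString N) ℂ :=
  U * (Matrix.diagonal (fun x => if x = (fun _ => false) then (-1 : ℂ) else 1) *
    (U.conjTranspose * Matrix.diagonal fun x => if (energy x : ℕ∞) < s then (-1 : ℂ) else 1))

theorem implements_amplify (I : Implementation U) (s : ℕ∞) :
    Implements (I.amplify s) (amplifyMatrix U s) := by
  have hprep : Implements I.prep U := I.prep_spec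
  have horacle : Implements (I.oracle s)
      (Matrix.diagonal fun x => if (energy x : ℕ∞) < s then (-1 : ℂ) else 1) := by
    refine implements_diagonal fun x => ?_
    rw [oracle, runCircuit_append, runCircuit_append, I.cost_spec, I.compare_spec, runCircuit_smul,
      ← I.cost_spec, runCircuit_inverseCircuit]
  exact ((horacle.append (hprep.inverse I.mul_conjTranspose_self)).append
    (implements_diagonal I.reflect_spec)).append hprep

theorem implements_replicate {w : ℕ} {c : Circuit (Fin N ⊕ Fin w)}
    {A : Matrix (BitString N) (BitString N) ℂ} (h : Implements c A) (j : ℕ) :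
    Implements (List.replicate j c).flatten (A ^ j) := by
  induction j with
  | zero =>
    rw [pow_zero, ← Matrix.diagonal_one]
    exact implements_diagonal fun x => by simp
  | succ j ih =>
    rw [List.replicate_succ, List.flatten_cons, pow_succ]
    exact h.append ih

theorem reflection_mulVec (I : Implementation U) (u : BitString N → ℂ) (x : BitString N) :
    (U * (Matrix.diagonal (fun x => if x = (fun _ => false) then (-1 : ℂ) else 1) *
      U.conjTranspose)).mulVec u x
      = u x - 2 * (∑ y, star (U y fun _ => false) * u y) * U x fun _ => false := by
  have h : U * (Matrix.diagonal (fun x => if x = (fun _ => false) then (-1 : ℂ) else 1) *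
      U.conjTranspose) = 1 - (2 : ℂ) • Matrix.of fun x y =>
        U x (fun _ => false) * star (U y fun _ => false) := by
    rw [← I.mul_conjTranspose_self]
    ext x y
    rw [Matrix.sub_apply, Matrix.smul_apply, Matrix.of_apply, Matrix.mul_apply, Matrix.mul_apply]
    simp only [Matrix.diagonal_mul, Matrix.conjTranspose_apply, smul_eq_mul]
    have h1 : ∀ z, U x z * ((if z = (fun _ => false) then (-1 : ℂ) else 1) * star (U y z))
        = U x z * star (U y z) - if z = (fun _ => false) then
          2 * (U x (fun _ => false) * star (U y fun _ => false)) else 0 := by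
      intro z
      split
      · next h => subst h; ring
      · ring
    simp only [h1, Finset.sum_sub_distrib, Finset.sum_ite_eq', Finset.mem_univ, if_true]
  rw [h, Matrix.sub_mulVec, Matrix.one_mulVec, Matrix.smul_mulVec]
  simp only [Pi.sub_apply, Pi.smul_apply, smul_eq_mul, Matrix.mulVec, dotProduct, Matrix.of_apply]
  rw [Finset.mul_sum, Finset.mul_sum, Finset.sum_mul]
  congr 1
  exact Finset.sum_congr rfl fun y _ => by ring

theorem amplifyMatrix_mulVec (I : Implementation U) (s : ℕ∞) (j : ℕ) :
    (amplifyMatrix U s).mulVec (amplified U s j) = amplified U s (j + 1) := by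
  have h1 : amplifyMatrix U s = (U * (Matrix.diagonal
      (fun x => if x = (fun _ => false) then (-1 : ℂ) else 1) * U.conjTranspose)) *
      Matrix.diagonal fun x => if (energy x : ℕ∞) < s then (-1 : ℂ) else 1 := by
    rw [amplifyMatrix]; simp only [Matrix.mul_assoc]
  set P := markedProb U s with hP
  set a := (ampCoeff P j).1 with ha
  set b := (ampCoeff P j).2 with hb
  -- The overlap of |ψ⟩ with the state after the phase oracle, which is the quantity subtracted
  -- twice in `ampCoeff`.
  have h2 : ∑ y, star (U y fun _ => false) *
      ((if (energy y : ℕ∞) < s then (-1 : ℂ) else 1) * amplified U s j y)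
      = ((-a * P + b * (1 - P) : ℝ) : ℂ) := by
    have h3 : ∀ y, star (U y fun _ => false) *
        ((if (energy y : ℕ∞) < s then (-1 : ℂ) else 1) * amplified U s j y)
        = ((-a * (if (energy y : ℕ∞) < s then ‖U y fun _ => false‖ ^ 2 else 0) +
          b * (‖U y fun _ => false‖ ^ 2 -
            if (energy y : ℕ∞) < s then ‖U y fun _ => false‖ ^ 2 else 0) : ℝ) : ℂ) := by
      intro y
      have h4 : star (U y fun _ => false) * U y (fun _ => false)
          = ((‖U y fun _ => false‖ ^ 2 : ℝ) : ℂ) := by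
        rw [RCLike.star_def, Complex.conj_mul']; push_cast; rfl
      rw [amplified]
      split
      · simp only [← hP, ← ha, sub_self, mul_zero, add_zero]
        rw [Complex.ofReal_mul, ← h4]; push_cast; ring
      · simp only [← hP, ← hb, sub_zero, mul_zero, zero_add]
        rw [Complex.ofReal_mul, ← h4]; ring
    simp only [h3]
    rw [← Complex.ofReal_sum, Finset.sum_add_distrib, ← Finset.mul_sum, ← Finset.mul_sum,
      Finset.sum_sub_distrib, I.sum_normSq]
    rfl
  funext x
  rw [h1, ← Matrix.mulVec_mulVec, I.reflection_mulVec]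
  simp only [Matrix.mulVec_diagonal]
  rw [h2]
  simp only [amplified, ampCoeff, ← hP, ← ha, ← hb]
  split
  · push_cast; ring
  · push_cast; ring

theorem run_attempt (I : Implementation U) (s : ℕ∞) (j : ℕ) :
    runCircuit (I.attempt s j) (ket fun _ => false)
      = ∑ x, amplified U s j x • ket₂ x (I.workAfter x) := by
  have h0 : (ket fun _ => false : QState (Fin N ⊕ Fin I.work))
      = ket₂ (fun _ => false) fun _ => false := by
    rw [ket₂]; congr 1; funext i; cases i <;> rfl
  have h1 : ((amplifyMatrix U s) ^ j).mulVec (amplified U s 0) = amplified U s j := by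
    induction j with
    | zero => simp
    | succ j ih => rw [pow_succ', ← Matrix.mulVec_mulVec, ih, I.amplifyMatrix_mulVec]
  have h2 : ∀ x, amplified U s 0 x = U x fun _ => false := by
    intro x; simp [amplified, ampCoeff]
  rw [attempt, runCircuit_append, runCircuit_append, h0, I.prep_spec]
  simp only [← h2]
  rw [(implements_replicate (I.implements_amplify s) j).run, h1, runCircuit_sum_smul]
  simp only [I.cost_spec]

theorem sum_measureAll_attempt (I : Implementation U) (s : ℕ∞) (j : ℕ)
    (g : (Fin N ⊕ Fin I.work → Bool) → ℝ) :
    ∑ z, (measureAll (I.attempt s j) z).toReal * g z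
      = ∑ x, ‖amplified U s j x‖ ^ 2 * g (Sum.elim x (I.workAfter x)) := by
  rw [← sum_normSq_smul_ket₂_mul, ← run_attempt]
  refine Finset.sum_congr rfl fun z _ => ?_
  rw [measureAll, PMF.ofFintype_apply, ENNReal.toReal_ofReal (by positivity)]

theorem readValue_outcome (I : Implementation U) (x : BitString N) :
    I.readValue (Sum.elim x (I.workAfter x)) = energy x := I.cost_value x

/-- The final state is supported on the basis states |x⟩|workAfter x⟩, so the value read is always
the true energy. -/
theorem eq_outcome_of_mem_support (I : Implementation U) (s : ℕ∞) (j : ℕ)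
    (z : Fin N ⊕ Fin I.work → Bool) (hz : z ∈ (measureAll (I.attempt s j)).support) :
    I.readValue z = energy fun i => z (Sum.inl i) := by
  rw [PMF.mem_support_iff, measureAll, PMF.ofFintype_apply, run_attempt, sum_smul_ket₂_apply] at hz
  by_cases h : (fun i => z (Sum.inr i)) = I.workAfter fun i => z (Sum.inl i)
  · rw [readValue, h, I.cost_value]
  · simp [h] at hz

theorem sum_normSq_amplified (I : Implementation U) (s : ℕ∞) (j : ℕ) :
    ∑ x, ‖amplified U s j x‖ ^ 2 = 1 := by
  have h1 := I.sum_measureAll_attempt s j 1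
  simp only [Pi.one_apply, mul_one] at h1
  rw [← h1, ← ENNReal.toReal_sum fun z _ => PMF.apply_ne_top _ z, ← tsum_fintype (L := .unconditional _),
    PMF.tsum_coe, ENNReal.toReal_one]

end Implementation

end Amplification

/-! ### Real-valued probabilities of events. -/

section Probability

/-- The probability of an event, as a real number. -/
def prob {α : Type} (p : PMF α) (S : Set α) : ℝ := (p.toOuterMeasure S).toReal

theorem toOuterMeasure_le_one {α : Type} (p : PMF α) (S : Set α) : p.toOuterMeasure S ≤ 1 := by
  have h : p.toOuterMeasure Set.univ = 1 :=
    (PMF.toOuterMeasure_apply_eq_one_iff p _).2 (Set.subset_univ _)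
  rw [← h]
  exact MeasureTheory.measure_mono (Set.subset_univ S)

theorem toOuterMeasure_ne_top {α : Type} (p : PMF α) (S : Set α) : p.toOuterMeasure S ≠ ⊤ :=
  ((toOuterMeasure_le_one p S).trans_lt ENNReal.one_lt_top).ne

theorem prob_le_one {α : Type} (p : PMF α) (S : Set α) : prob p S ≤ 1 :=
  ENNReal.toReal_le_of_le_ofReal zero_le_one (by simpa using toOuterMeasure_le_one p S)

theorem prob_bind {α β : Type} [Fintype α] (p : PMF α) (f : α → PMF β) (S : Set β) :
    prob (p.bind f) S = ∑ a, (p a).toReal * prob (f a) S := by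
  rw [prob, PMF.toOuterMeasure_bind_apply, tsum_fintype, ENNReal.toReal_sum]
  · simp only [ENNReal.toReal_mul, prob]
  · exact fun a _ => ENNReal.mul_ne_top (PMF.apply_ne_top _ _) (toOuterMeasure_ne_top _ _)

end Probability

/-! ### The potential bound for exponential search. -/

section Search

variable {N : ℕ} {U : Matrix (BitString N) (BitString N) ℂ}

/-- The expectation of `Φ` at the energy of a sample of `U|0…0⟩`, given that this energy is less
than `s`. -/
def conditionalMean (U : Matrix (BitString N) (BitString N) ℂ) (s : ℕ∞) (Φ : ℕ∞ → ℝ) : ℝ :=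
  (∑ x, if (energy x : ℕ∞) < s then ‖U x fun _ => false‖ ^ 2 * Φ (energy x) else 0) /
    markedProb U s

/-- The probability that an attempt with `j` steps finds a marked element. -/
def hitProb (P : ℝ) (j : ℕ) : ℝ := (ampCoeff P j).1 ^ 2 * P

theorem hitProb_eq (I : Implementation U) (s : ℕ∞) (j : ℕ) :
    hitProb (markedProb U s) j
      = Real.sin ((2 * j + 1) * Real.arcsin √(markedProb U s)) ^ 2 :=
  ampCoeff_sq_mul (markedProb_nonneg U s) (I.markedProb_le_one s) j

theorem hitProb_nonneg (I : Implementation U) (s : ℕ∞) (j : ℕ) :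
    0 ≤ hitProb (markedProb U s) j := by
  rw [hitProb_eq I]; positivity

theorem hitProb_le_one (I : Implementation U) (s : ℕ∞) (j : ℕ) :
    hitProb (markedProb U s) j ≤ 1 := by
  rw [hitProb_eq I]; exact Real.sin_sq_le_one _

/-- All marked amplitudes are scaled by the same factor, so conditioning on a hit gives the same law
for every `j`. -/
theorem sum_amplified_marked (s : ℕ∞) (j : ℕ) (Φ : ℕ∞ → ℝ) (hP : 0 < markedProb U s) :
    ∑ x, ‖amplified U s j x‖ ^ 2 * (if (energy x : ℕ∞) < s then Φ (energy x) else 0)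
      = hitProb (markedProb U s) j * conditionalMean U s Φ := by
  rw [hitProb, conditionalMean, mul_assoc, mul_div_cancel₀ _ hP.ne', Finset.mul_sum]
  refine Finset.sum_congr rfl fun x _ => ?_
  split
  · next h =>
    rw [amplified, if_pos h, norm_mul, mul_pow, Complex.norm_real, Real.norm_eq_abs, sq_abs]
    ring
  · ring

theorem sum_amplified_unmarked (I : Implementation U) (s : ℕ∞) (j : ℕ) (y : ℝ)
    (hP : 0 < markedProb U s) :
    ∑ x, ‖amplified U s j x‖ ^ 2 * (if (energy x : ℕ∞) < s then 0 else y)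
      = (1 - hitProb (markedProb U s) j) * y := by
  have h1 := sum_amplified_marked s j (fun _ => 1) hP
  have h2 : conditionalMean U s (fun _ => 1) = 1 := by
    rw [conditionalMean]
    simp only [mul_one]
    exact div_self hP.ne'
  rw [h2, mul_one] at h1
  have h3 := I.sum_normSq_amplified s j
  rw [← h1]
  nth_rewrite 1 [← h3]
  rw [← Finset.sum_sub_distrib, Finset.sum_mul]
  refine Finset.sum_congr rfl fun x _ => ?_
  split <;> ring

theorem conditionalMean_nonneg (s : ℕ∞) (Φ : ℕ∞ → ℝ) (hΦ : ∀ e, 0 ≤ Φ e) :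
    0 ≤ conditionalMean U s Φ := by
  refine div_nonneg (Finset.sum_nonneg fun x _ => ?_) (markedProb_nonneg U s)
  have := hΦ (energy x)
  split <;> positivity

/-- A trial at scale `m` therefore costs 2m calls on average. -/
theorem sum_attemptCalls (m : ℕ) :
    ∑ j ∈ Finset.range m, (attemptCalls j : ℝ) = 2 * m * m := by
  induction m with
  | zero => simp
  | succ m ih => rw [Finset.sum_range_succ, ih, attemptCalls]; push_cast; ring

/-- The potential bound for a search that is followed by `k`. Here `W t` bounds the expected number
of calls that the search makes after the first `t` attempts, and `Φ` bounds the expected number of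
calls that are needed after the search. -/
theorem eqSearch_bind_bound (I : Implementation U) (s : ℕ∞) (ε : ℝ) (hP : 0 < markedProb U s)
    (B : ℕ) (S : Set (RunResult N)) (k : SearchResult N → PMF (RunResult N))
    (Φ : ℕ∞ → ℝ) (hΦ : ∀ e, 0 ≤ Φ e) (W : ℕ → ℝ) (hW0 : ∀ t, 0 ≤ W t)
    (hW : ∀ t, 2 * ((2 ^ (t / attemptsPerScale ε) : ℕ) : ℝ) * (2 ^ (t / attemptsPerScale ε) : ℕ) +
      ((2 ^ (t / attemptsPerScale ε) : ℕ) -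
        ∑ j ∈ Finset.range (2 ^ (t / attemptsPerScale ε)), hitProb (markedProb U s) j) * W (t + 1)
      ≤ (2 ^ (t / attemptsPerScale ε) : ℕ) * W t)
    (calls₀ : ℕ)
    (hk : ∀ (x : BitString N) (calls gates : ℕ), (energy x : ℕ∞) < s → calls < calls₀ →
      B * prob (k ⟨some ⟨x, energy x⟩, calls, gates⟩) S + calls ≤ B + Φ (energy x))
    (calls : ℕ) (hc : calls ≤ calls₀) (t gates : ℕ) :
    B * prob ((eqSearch I s ε t calls gates).bind k) S + calls
      ≤ B + conditionalMean U s Φ + W t := by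
  induction calls using Nat.strong_induction_on generalizing t gates with
  | _ calls ih =>
  set m := 2 ^ (t / attemptsPerScale ε) with hm
  have hm0 : 0 < (m : ℝ) := by rw [hm]; positivity
  set V := conditionalMean U s Φ with hV
  have hV0 : 0 ≤ V := conditionalMean_nonneg s Φ hΦ
  have hB : (0 : ℝ) ≤ B := Nat.cast_nonneg B
  rw [eqSearch, PMF.bind_bind, prob_bind]
  simp only [PMF.uniformOfFintype_apply, Fintype.card_fin, ENNReal.toReal_inv,
    ENNReal.toReal_natCast, ← hm]
  -- For fixed `j`, a hit leaves mean cost `V` and a miss leaves `V + W (t + 1)`, besides the calls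
  -- just made. Averaging over `j` and applying `hW` gives the claim.
  have key : ∀ j : Fin m,
      B * prob ((if _h : attemptCalls j ≤ calls then
        (measureAll (I.attempt s j)).bind fun c =>
          if (I.readValue c : ℕ∞) < s then
            PMF.pure ⟨some ⟨fun i => c (Sum.inl i), I.readValue c⟩, calls - attemptCalls j,
              gates + (I.attempt s j).length⟩
          else
            eqSearch I s ε (t + 1) (calls - attemptCalls j) (gates + (I.attempt s j).length)
        else PMF.pure (⟨none, calls, gates⟩ : SearchResult N)).bind k) S + calls
      ≤ B + V + attemptCalls j + (1 - hitProb (markedProb U s) j) * W (t + 1) := by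
    intro j
    have hj1 := hitProb_le_one I s j
    have hW1 : 0 ≤ (1 - hitProb (markedProb U s) j) * W (t + 1) :=
      mul_nonneg (by linarith) (hW0 _)
    by_cases h : attemptCalls j ≤ calls
    · have hpos : 0 < attemptCalls (j : ℕ) := by simp [attemptCalls]
      have hcast : ((calls - attemptCalls j : ℕ) : ℝ) = calls - attemptCalls j := Nat.cast_sub h
      rw [dif_pos h, PMF.bind_bind, prob_bind, I.sum_measureAll_attempt s j
        (fun c => prob (PMF.bind (if (I.readValue c : ℕ∞) < s then
            PMF.pure (⟨some ⟨fun i => c (Sum.inl i), I.readValue c⟩, calls - attemptCalls j,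
              gates + (I.attempt s j).length⟩ : SearchResult N)
          else
            eqSearch I s ε (t + 1) (calls - attemptCalls j)
              (gates + (I.attempt s j).length)) k) S)]
      simp only [I.readValue_outcome, Sum.elim_inl]
      have hterm : ∀ x : BitString N, B * prob (PMF.bind (if (energy x : ℕ∞) < s then
            PMF.pure (⟨some ⟨fun i => x i, energy x⟩, calls - attemptCalls j,
              gates + (I.attempt s j).length⟩ : SearchResult N)
          else
            eqSearch I s ε (t + 1) (calls - attemptCalls j)
              (gates + (I.attempt s j).length)) k) S
          ≤ (B - (calls - attemptCalls j)) + ((if (energy x : ℕ∞) < s then Φ (energy x) else 0) +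
            if (energy x : ℕ∞) < s then 0 else V + W (t + 1)) := by
        intro x
        by_cases hx : (energy x : ℕ∞) < s
        · simp only [if_pos hx, PMF.pure_bind]
          have := hk x (calls - attemptCalls j) (gates + (I.attempt s j).length) hx (by omega)
          rw [hcast] at this
          linarith
        · simp only [if_neg hx]
          have := ih (calls - attemptCalls j) (by omega) (by omega) (t + 1)
            (gates + (I.attempt s j).length)
          rw [hcast] at this
          linarith
      have hsum : B * ∑ x, ‖amplified U s j x‖ ^ 2 * prob (PMF.bind (if (energy x : ℕ∞) < s then
            PMF.pure (⟨some ⟨fun i => x i, energy x⟩, calls - attemptCalls j,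
              gates + (I.attempt s j).length⟩ : SearchResult N)
          else
            eqSearch I s ε (t + 1) (calls - attemptCalls j)
              (gates + (I.attempt s j).length)) k) S
          ≤ ∑ x, (‖amplified U s j x‖ ^ 2 * (B - (calls - attemptCalls j)) +
            (‖amplified U s j x‖ ^ 2 * (if (energy x : ℕ∞) < s then Φ (energy x) else 0) +
            ‖amplified U s j x‖ ^ 2 * if (energy x : ℕ∞) < s then 0 else V + W (t + 1))) := by
        rw [Finset.mul_sum]
        refine Finset.sum_le_sum fun x _ => ?_
        have := mul_le_mul_of_nonneg_left (hterm x) (sq_nonneg ‖amplified U s j x‖)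
        linarith
      rw [Finset.sum_add_distrib, Finset.sum_add_distrib, ← Finset.sum_mul,
        I.sum_normSq_amplified, sum_amplified_marked _ _ _ hP,
        sum_amplified_unmarked I _ _ _ hP, ← hV] at hsum
      linarith
    -- The search stops here; even certain failure is covered, since fewer than `attemptCalls j`
    -- calls remain.
    · rw [dif_neg h, PMF.pure_bind]
      have h1 := mul_le_mul_of_nonneg_left (prob_le_one (k ⟨none, calls, gates⟩) S) hB
      have h2 : (calls : ℝ) ≤ attemptCalls j := by exact_mod_cast (not_le.1 h).le
      linarith
  have hsum := Finset.sum_le_sum fun (j : Fin m) (_ : j ∈ Finset.univ) => key j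
  rw [Finset.sum_add_distrib, Finset.sum_add_distrib, Finset.sum_add_distrib, ← Finset.mul_sum,
    ← Finset.sum_mul, Finset.sum_sub_distrib] at hsum
  rw [Fin.sum_univ_eq_sum_range (fun j => (attemptCalls j : ℝ)) m, sum_attemptCalls,
    Fin.sum_univ_eq_sum_range (fun j => hitProb (markedProb U s) j) m] at hsum
  simp only [Finset.sum_const, Finset.card_univ, Fintype.card_fin, nsmul_eq_mul, mul_one] at hsum
  rw [← Finset.mul_sum]
  have h3 := hW t
  rw [← hm] at h3
  refine le_of_mul_le_mul_left ?_ hm0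
  refine le_trans (le_of_eq ?_) ((hsum.trans (add_le_add_left h3 ((m : ℝ) * (B + V)) |>.trans' (le_of_eq ?_))).trans (le_of_eq ?_))
  · field_simp
    rfl
  · ring
  · ring

end Search

/-! ### Bounds on the cost of one search and on the cost of reaching the minimum. -/

section Potentials

theorem sum_two_pow_div (a k : ℕ) :
    ∑ i ∈ Finset.range (a * k), (2 : ℝ) ^ (i / a) = a * (2 ^ k - 1) := by
  rcases Nat.eq_zero_or_pos a with rfl | ha
  · simp
  induction k with
  | zero => simp
  | succ k ih =>
    rw [Nat.mul_succ, Finset.sum_range_add, ih]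
    have : ∀ i ∈ Finset.range a, (2 : ℝ) ^ ((a * k + i) / a) = 2 ^ k := by
      intro i hi
      rw [Nat.mul_add_div ha, Nat.div_eq_of_lt (Finset.mem_range.1 hi), add_zero]
    rw [Finset.sum_congr rfl this, Finset.sum_const, Finset.card_range, nsmul_eq_mul, pow_succ]
    ring

theorem exists_two_pow_between {y : ℝ} (hy : 1 ≤ y) : ∃ k : ℕ, y ≤ 2 ^ k ∧ (2 : ℝ) ^ k ≤ 2 * y := by
  obtain ⟨n, hn1, hn2⟩ := exists_nat_pow_near hy one_lt_two
  refine ⟨n + 1, hn2.le, ?_⟩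
  rw [pow_succ]; linarith

/-- There is a bound `W t` on the expected number of calls of a search after its first `t` attempts
that satisfies the recursion, and `W 0 = O(a / √P)`. -/
theorem exists_searchBound {P : ℝ} (hP : 0 < P) (hP1 : P ≤ 1) (a : ℕ) (ha : 5 ≤ a)
    (q : ℕ → ℝ) (hq0 : ∀ j, 0 ≤ q j)
    (hq : ∀ m : ℕ, 1 ≤ m * √P → (m : ℝ) / 4 ≤ ∑ j ∈ Finset.range m, q j) :
    ∃ W : ℕ → ℝ, (∀ t, 0 ≤ W t) ∧
      (∀ t, 2 * ((2 ^ (t / a) : ℕ) : ℝ) * (2 ^ (t / a) : ℕ) +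
        ((2 ^ (t / a) : ℕ) - ∑ j ∈ Finset.range (2 ^ (t / a)), q j) * W (t + 1)
        ≤ (2 ^ (t / a) : ℕ) * W t) ∧
      W 0 ≤ (4 * a + 32) * (1 / √P) := by
  have hs0 : 0 < √P := Real.sqrt_pos.2 hP
  have hs1 : √P ≤ 1 := Real.sqrt_le_one.2 hP1
  obtain ⟨k, hk1, hk2⟩ := exists_two_pow_between (y := 1 / √P) (by rw [le_div_iff₀ hs0]; linarith)
  have ha0 : 0 < a := by omega
  have hm0 : ∀ t, (0 : ℝ) < (2 : ℝ) ^ (t / a) := fun t => by positivity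
  -- Trials below scale 2^k are charged their mean cost 2·2^(i/a), with no credit for hits. From
  -- scale 2^k ≥ 1/√P on, a miss has probability at most 3/4, and since (7/6)^5 ≥ 2 and a ≥ 5 the
  -- scale is at most Y = 2^k (7/6)^(t - ak). The bound 16Y solves the recursion because 2 +
  -- (3/4)(7/6)·16 = 16.
  refine ⟨fun t => 16 * 2 ^ k * (7 / 6 : ℝ) ^ (t - a * k) +
    ∑ i ∈ Finset.Ico t (a * k), 2 * (2 : ℝ) ^ (i / a), fun t => by positivity, fun t => ?_, ?_⟩
  · push_cast
    rcases lt_or_ge t (a * k) with ht | ht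
    · have e1 : t - a * k = 0 := by omega
      have e2 : t + 1 - a * k = 0 := by omega
      rw [e1, e2, Finset.sum_eq_sum_Ico_succ_bot ht]
      have hX : 0 ≤ 16 * 2 ^ k * (7 / 6 : ℝ) ^ 0 +
        ∑ i ∈ Finset.Ico (t + 1) (a * k), 2 * (2 : ℝ) ^ (i / a) := by positivity
      have := mul_nonneg (Finset.sum_nonneg fun j (_ : j ∈ Finset.range (2 ^ (t / a))) => hq0 j) hX
      nlinarith
    · have e2 : t + 1 - a * k = (t - a * k) + 1 := by omega
      rw [e2, Finset.Ico_eq_empty (by omega), Finset.Ico_eq_empty (by omega), Finset.sum_empty,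
        add_zero, add_zero, pow_succ]
      have hkt : k ≤ t / a := (Nat.le_div_iff_mul_le ha0).2 (by rwa [mul_comm])
      have hm : 1 ≤ ((2 ^ (t / a) : ℕ) : ℝ) * √P := by
        have h1 : (2 : ℝ) ^ k ≤ 2 ^ (t / a) := pow_le_pow_right₀ one_le_two hkt
        push_cast
        rw [← div_le_iff₀ hs0]
        exact hk1.trans h1
      have hquarter := hq _ hm
      push_cast at hquarter
      have hgrow : (2 : ℝ) ^ (t / a) ≤ 2 ^ k * (7 / 6 : ℝ) ^ (t - a * k) := by
        obtain ⟨n, hn⟩ := Nat.exists_eq_add_of_le hkt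
        have h1 : a * n ≤ t - a * k := by
          have := Nat.mul_div_le t a
          rw [hn, mul_add] at this
          omega
        rw [hn, pow_add]
        refine mul_le_mul_of_nonneg_left ?_ (by positivity)
        calc (2 : ℝ) ^ n ≤ ((7 / 6 : ℝ) ^ 5) ^ n :=
              pow_le_pow_left₀ (by norm_num) (by norm_num) n
          _ = (7 / 6 : ℝ) ^ (5 * n) := by rw [pow_mul]
          _ ≤ (7 / 6 : ℝ) ^ (t - a * k) := pow_le_pow_right₀ (by norm_num)
              ((Nat.mul_le_mul_right n ha).trans h1)
      set m := (2 : ℝ) ^ (t / a)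
      set Y := 2 ^ k * (7 / 6 : ℝ) ^ (t - a * k)
      have hY : 0 ≤ Y := by positivity
      have h2 : (m - ∑ j ∈ Finset.range (2 ^ (t / a)), q j) * Y ≤ (3 / 4 * m) * Y :=
        mul_le_mul_of_nonneg_right (by linarith) hY
      have h3 : m * m ≤ m * Y := mul_le_mul_of_nonneg_left hgrow (hm0 t).le
      calc _ = 2 * (m * m) + 56 / 3 * ((m - ∑ j ∈ Finset.range (2 ^ (t / a)), q j) * Y) := by
            simp only [Y]; ring
        _ ≤ 2 * (m * Y) + 56 / 3 * ((3 / 4 * m) * Y) := by linarith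
        _ = _ := by simp only [Y]; ring
  · simp only [Nat.zero_sub, pow_zero, mul_one]
    rw [← Finset.range_eq_Ico, ← Finset.mul_sum, sum_two_pow_div]
    have ha' : (0 : ℝ) ≤ a := Nat.cast_nonneg a
    nlinarith

variable {N : ℕ} {U : Matrix (BitString N) (BitString N) ℂ}

theorem markedProb_mono {s s' : ℕ∞} (h : s ≤ s') : markedProb U s ≤ markedProb U s' := by
  refine Finset.sum_le_sum fun x _ => ?_
  by_cases hx : (energy x : ℕ∞) < s
  · rw [if_pos hx, if_pos (hx.trans_le h)]
  · rw [if_neg hx]; split <;> positivity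

theorem markedProb_eq_zero {s : ℕ∞} (h : ∀ x : BitString N, s ≤ energy x) : markedProb U s = 0 :=
  Finset.sum_eq_zero fun x _ => if_neg (not_lt.2 (h x))

/-- The probability that `U|0…0⟩` is optimal, if `e₀` is the least energy. -/
def optProb (U : Matrix (BitString N) (BitString N) ℂ) (e₀ : ℕ) : ℝ :=
  markedProb U ((e₀ + 1 : ℕ) : ℕ∞)

/-- The bound on the expected number of calls until an optimal element is found, if searches with
threshold `s` make at most `w / √(markedProb U s)` calls. -/
def loopBound (U : Matrix (BitString N) (BitString N) ℂ) (e₀ : ℕ) (w : ℝ) (s : ℕ∞) : ℝ :=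
  if s ≤ e₀ then 0 else w * (2 / √(optProb U e₀) - 1 / √(markedProb U s))

theorem optProb_le {e₀ : ℕ} {s : ℕ∞} (hs : ¬ s ≤ e₀) : optProb U e₀ ≤ markedProb U s := by
  refine markedProb_mono ?_
  rw [Nat.cast_add, Nat.cast_one]
  exact Order.add_one_le_of_lt (not_le.1 hs)

theorem loopBound_nonneg {e₀ : ℕ} (h0 : 0 < optProb U e₀) {w : ℝ} (hw : 0 ≤ w) (s : ℕ∞) :
    0 ≤ loopBound U e₀ w s := by
  rw [loopBound]
  split
  · exact le_rfl
  · next hs =>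
    have h1 := Real.sqrt_le_sqrt (optProb_le (U := U) hs)
    have h2 : 0 < √(optProb U e₀) := Real.sqrt_pos.2 h0
    have h3 := one_div_le_one_div_of_le h2 h1
    have h4 : 0 < 1 / √(optProb U e₀) := by positivity
    have h5 : 2 / √(optProb U e₀) = 2 * (1 / √(optProb U e₀)) := by ring
    exact mul_nonneg hw (by linarith)

theorem loopBound_le {e₀ : ℕ} {w : ℝ} (hw : 0 ≤ w) (s : ℕ∞) :
    loopBound U e₀ w s ≤ 2 * w * (1 / √(optProb U e₀)) := by
  rw [loopBound]
  split
  · positivity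
  · have : 0 ≤ w * (1 / √(markedProb U s)) := by positivity
    have h5 : w * (2 / √(optProb U e₀) - 1 / √(markedProb U s))
      = 2 * w * (1 / √(optProb U e₀)) - w * (1 / √(markedProb U s)) := by ring
    linarith

/-- Comparison with ∫ dP/√P: an energy level that raises the cumulative probability from a to b
contributes (b - a)/√a ≥ 2√b - 2√a. -/
theorem two_mul_sqrt_sub_le_sum {e₀ : ℕ} (h0 : 0 < optProb U e₀) (n : ℕ) (hn : e₀ + 1 ≤ n) :
    2 * √(markedProb U n) - 2 * √(optProb U e₀) ≤ ∑ x : BitString N,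
      if (energy x : ℕ∞) < (n : ℕ) then
        ‖U x fun _ => false‖ ^ 2 * (1 / √(markedProb U (energy x))) else 0 := by
  induction n, hn using Nat.le_induction with
  | base =>
    rw [optProb, sub_self]
    exact Finset.sum_nonneg fun x _ => by split <;> positivity
  | succ n hn ih =>
    set a := markedProb U (n : ℕ∞) with ha
    set b := markedProb U ((n + 1 : ℕ) : ℕ∞) with hb
    have hab : a ≤ b := markedProb_mono (by exact_mod_cast Nat.le_succ n)
    have ha0 : 0 < a := h0.trans_le (markedProb_mono (by exact_mod_cast hn))
    have hsplit : ∀ (f : BitString N → ℝ) (x : BitString N),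
        (if (energy x : ℕ∞) < ((n + 1 : ℕ) : ℕ∞) then f x else 0)
          = (if (energy x : ℕ∞) < (n : ℕ) then f x else 0) + if energy x = n then f x else 0 := by
      intro f x
      simp only [Nat.cast_lt]
      rcases lt_trichotomy (energy x) n with h | h | h
      · rw [if_pos (by omega), if_pos h, if_neg (by omega), add_zero]
      · rw [if_pos (by omega), if_neg (by omega), if_pos h, zero_add]
      · rw [if_neg (by omega), if_neg (by omega), if_neg (by omega), add_zero]
    have hdiff : ∑ x : BitString N, (if energy x = n then ‖U x fun _ => false‖ ^ 2 else 0)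
        = b - a := by
      rw [hb, ha, markedProb, markedProb, ← Finset.sum_sub_distrib]
      refine Finset.sum_congr rfl fun x _ => ?_
      have h := hsplit (fun x => ‖U x fun _ => false‖ ^ 2) x
      beta_reduce at h
      linarith
    have hlast : ∑ x : BitString N, (if energy x = n then
        ‖U x fun _ => false‖ ^ 2 * (1 / √(markedProb U (energy x))) else 0)
        = (b - a) * (1 / √a) := by
      rw [← hdiff, Finset.sum_mul]
      refine Finset.sum_congr rfl fun x _ => ?_
      split
      · next h => rw [h]
      · ring
    simp only [hsplit fun x => ‖U x fun _ => false‖ ^ 2 * (1 / √(markedProb U (energy x))),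
      Finset.sum_add_distrib]
    rw [hlast]
    have hsa : 0 < √a := Real.sqrt_pos.2 ha0
    have h1 := Real.sqrt_le_sqrt hab
    have h2 : 2 * √b - 2 * √a ≤ (b - a) * (1 / √a) := by
      rw [mul_one_div, le_div_iff₀ hsa]
      have h3 := Real.sq_sqrt ha0.le
      have h4 := Real.sq_sqrt (ha0.le.trans hab)
      nlinarith [sq_nonneg (√b - √a)]
    linarith

/-- Makes the initial threshold ∞ finite, so that induction over energy levels applies. -/
theorem exists_nat_threshold (s : ℕ∞) :
    ∃ n : ℕ, ∀ x : BitString N, (energy x : ℕ∞) < s ↔ (energy x : ℕ∞) < (n : ℕ) := by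
  induction s using ENat.recTopCoe with
  | top =>
    refine ⟨2 ^ N ^ 3, fun x => ?_⟩
    have := energy_lt N x
    exact ⟨fun _ => by exact_mod_cast this, fun _ => ENat.natCast_lt_top _⟩
  | coe n => exact ⟨n, fun x => Iff.rfl⟩

/-- By `two_mul_sqrt_sub_le_sum`, the mean potential after a search is at most w(2/√P₀ - 2/√P),
which is w/√P below the potential before it. -/
theorem conditionalMean_loopBound_le {x₀ : BitString N} (hx₀ : IsOptimal x₀)
    (h0 : 0 < optProb U (energy x₀)) {w : ℝ} (hw : 0 ≤ w) {s : ℕ∞} (hs : ¬ s ≤ energy x₀) :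
    conditionalMean U s (loopBound U (energy x₀) w) + w * (1 / √(markedProb U s))
      ≤ loopBound U (energy x₀) w s := by
  have hP : 0 < markedProb U s := h0.trans_le (optProb_le hs)
  obtain ⟨n, hn⟩ := exists_nat_threshold (N := N) s
  have hPn : markedProb U s = markedProb U (n : ℕ) := by
    simp only [markedProb, hn]
  have hn0 : energy x₀ + 1 ≤ n := by
    have := (hn x₀).1 (not_le.1 hs)
    have := Nat.cast_lt.1 this
    omega
  have hD := two_mul_sqrt_sub_le_sum h0 n hn0
  rw [← hPn] at hD
  set P := markedProb U s with hPdef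
  set P₀ := optProb U (energy x₀) with hP₀
  have hsP : 0 < √P := Real.sqrt_pos.2 hP
  have hsP₀ : 0 < √P₀ := Real.sqrt_pos.2 h0
  have hsqP : √P ^ 2 = P := Real.sq_sqrt hP.le
  have hsqP₀ : √P₀ ^ 2 = P₀ := Real.sq_sqrt h0.le
  -- Optimal strings have `markedProb` 0 at their own energy, and 1/√0 is 0 by convention, so the
  -- last sum may include them.
  have hterm : ∀ x : BitString N, (if (energy x : ℕ∞) < s then ‖U x fun _ => false‖ ^ 2 *
        loopBound U (energy x₀) w (energy x) else 0)
      = w * (2 / √P₀) * ((if (energy x : ℕ∞) < s then ‖U x fun _ => false‖ ^ 2 else 0) -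
          if (energy x : ℕ∞) < ((energy x₀ + 1 : ℕ) : ℕ∞) then ‖U x fun _ => false‖ ^ 2 else 0) -
        w * if (energy x : ℕ∞) < s then
          ‖U x fun _ => false‖ ^ 2 * (1 / √(markedProb U (energy x))) else 0 := by
    intro x
    by_cases hopt : energy x ≤ energy x₀
    · have h1 : (energy x : ℕ∞) < ((energy x₀ + 1 : ℕ) : ℕ∞) := by
        exact_mod_cast Nat.lt_succ_of_le hopt
      have h2 : (energy x : ℕ∞) < s := by
        have : (energy x : ℕ∞) ≤ energy x₀ := by exact_mod_cast hopt
        exact this.trans_lt (not_le.1 hs)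
      have h3 : markedProb U (energy x : ℕ∞) = 0 := markedProb_eq_zero fun y => by
        exact_mod_cast hopt.trans (hx₀ y)
      have h4 : loopBound U (energy x₀) w (energy x) = 0 := if_pos (by exact_mod_cast hopt)
      simp only [h1, h2, h3, h4, if_true]
      simp
    · have h1 : ¬ (energy x : ℕ∞) < ((energy x₀ + 1 : ℕ) : ℕ∞) := by
        rw [Nat.cast_lt]; omega
      have h4 : loopBound U (energy x₀) w (energy x)
          = w * (2 / √P₀ - 1 / √(markedProb U (energy x))) :=
        if_neg (by rw [Nat.cast_le]; exact hopt)
      rw [h4, if_neg h1]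
      split <;> ring
  have hsum : ∑ x : BitString N, (if (energy x : ℕ∞) < s then ‖U x fun _ => false‖ ^ 2 *
        loopBound U (energy x₀) w (energy x) else 0)
      ≤ w * (2 / √P₀) * (P - P₀) - w * (2 * √P - 2 * √P₀) := by
    simp only [hterm]
    rw [Finset.sum_sub_distrib, ← Finset.mul_sum, ← Finset.mul_sum, Finset.sum_sub_distrib]
    have := mul_le_mul_of_nonneg_left hD hw
    simp only [← hn] at this
    exact sub_le_sub_left this _
  rw [conditionalMean, loopBound, if_neg hs, ← hPdef, ← hP₀]
  have h1 : w * (2 / √P₀) * (P - P₀) - w * (2 * √P - 2 * √P₀)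
      = (w * (2 / √P₀ - 2 / √P)) * P := by
    have e1 : P₀ / √P₀ = √P₀ := Real.div_sqrt
    have e2 : P / √P = √P := Real.div_sqrt
    linear_combination (-2 * w) * e1 + 2 * w * e2
  rw [h1] at hsum
  have h2 := (div_le_iff₀ hP).2 hsum
  have h3 : w * (2 / √P₀ - 2 / √P) + w * (1 / √P) = w * (2 / √P₀ - 1 / √P) := by ring
  linarith

end Potentials

/-! ### Gate count and failure probability of one run of the loop. -/

section InnerLoop

variable {N : ℕ} {U : Matrix (BitString N) (BitString N) ℂ}

/-- The energy of the sample is the energy of its bitstring. -/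
def IsConsistent (o : Option (Sample N)) : Prop := ∀ a, o = some a → a.value = energy a.bits

/-- A trial with `j` steps has at most L + 2Lj gates and makes 4j + 2 calls, so L gates per call
suffice, with `compare` and `reflect` included. -/
theorem eqSearch_support (I : Implementation U) (L : ℕ) (hL : I.SizeLE L) (s : ℕ∞) (ε : ℝ)
    (t calls gates : ℕ) (r : SearchResult N) (hr : r ∈ (eqSearch I s ε t calls gates).support) :
    (∀ a, r.found = some a → a.value = energy a.bits ∧ (a.value : ℕ∞) < s ∧
      r.callsLeft < calls) ∧ r.gates + L * r.callsLeft ≤ gates + L * calls := by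
  induction calls using Nat.strong_induction_on generalizing t gates with
  | _ calls ih =>
  rw [eqSearch, PMF.mem_support_bind_iff] at hr
  obtain ⟨j, -, hr⟩ := hr
  by_cases h : attemptCalls j ≤ calls
  · have hpos : 0 < attemptCalls (j : ℕ) := by simp [attemptCalls]
    have hlen : (I.attempt s j).length + L * (calls - attemptCalls j) ≤ L * calls := by
      obtain ⟨c, hc⟩ := Nat.exists_eq_add_of_le h
      have h1 : (I.attempt s j).length ≤ L * attemptCalls j := by
        have h2 := hL s
        have h3 : (I.attempt s j).length = I.prep.length + j * (2 * I.prep.length +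
            2 * I.cost.length + (I.compare s).length + I.reflect.length) + I.cost.length := by
          simp only [Implementation.attempt, Implementation.amplify, Implementation.oracle,
            List.length_append, List.length_flatten, List.map_replicate, List.sum_replicate,
            length_inverseCircuit, smul_eq_mul]
          ring
        have h4 := Nat.mul_le_mul_left (j : ℕ) (show 2 * I.prep.length +
            2 * I.cost.length + (I.compare s).length + I.reflect.length ≤ 2 * L by omega)
        rw [h3, attemptCalls]
        nlinarith
      rw [hc, Nat.add_sub_cancel_left, mul_add]
      omega
    rw [dif_pos h, PMF.mem_support_bind_iff] at hr
    obtain ⟨z, hz, hr⟩ := hr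
    by_cases hzs : (I.readValue z : ℕ∞) < s
    · rw [if_pos hzs, PMF.mem_support_pure_iff] at hr
      subst hr
      refine ⟨fun a ha => ?_, ?_⟩
      · obtain rfl := Option.some.inj ha
        exact ⟨I.eq_outcome_of_mem_support s j z hz, hzs, by simp only; omega⟩
      · simp only; omega
    · rw [if_neg hzs] at hr
      obtain ⟨h1, h2⟩ := ih (calls - attemptCalls j) (by omega) _ _ hr
      refine ⟨fun a ha => ?_, by omega⟩
      obtain ⟨h3, h4, h5⟩ := h1 a ha
      exact ⟨h3, h4, by omega⟩
  · rw [dif_neg h, PMF.mem_support_pure_iff] at hr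
    subst hr
    exact ⟨fun a ha => by simp at ha, le_rfl⟩

theorem innerLoop_support (I : Implementation U) (L : ℕ) (hL : I.SizeLE L) (ε : ℝ)
    (fuel calls : ℕ) (last : Option (Sample N)) (gates : ℕ) (hlast : IsConsistent last)
    (r : RunResult N) (hr : r ∈ (innerLoop I ε fuel calls last gates).support) :
    IsConsistent r.output ∧ threshold r.output ≤ threshold last ∧
      r.gates ≤ gates + L * calls := by
  induction fuel generalizing calls last gates with
  | zero =>
    rw [innerLoop, PMF.mem_support_pure_iff] at hr
    subst hr
    exact ⟨hlast, le_rfl, Nat.le_add_right _ _⟩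
  | succ fuel ih =>
    rw [innerLoop, PMF.mem_support_bind_iff] at hr
    obtain ⟨q, hq, hr⟩ := hr
    obtain ⟨h1, h2⟩ := eqSearch_support I L hL _ _ _ _ _ q hq
    cases hf : q.found with
    | none =>
      rw [hf] at hr
      simp only [PMF.mem_support_pure_iff] at hr
      subst hr
      exact ⟨hlast, le_rfl, by simp only; omega⟩
    | some a =>
      rw [hf] at hr
      obtain ⟨h3, h4, h5⟩ := h1 a hf
      have hcons : IsConsistent (some a) := fun a' ha' => by
        obtain rfl := Option.some.inj ha'; exact h3
      obtain ⟨h6, h7, h8⟩ := ih _ _ _ hcons hr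
      exact ⟨h6, h7.trans h4.le, by omega⟩

/-- The runs whose output is optimal. -/
def optimalRuns (N : ℕ) : Set (RunResult N) := {r | ∃ a, r.output = some a ∧ IsOptimal a.bits}

/-- Success becomes a condition on the threshold, which only decreases in a run and becomes a
minimum under `better`. -/
theorem exists_optimal_iff {x₀ : BitString N} (hx₀ : IsOptimal x₀) {o : Option (Sample N)}
    (ho : IsConsistent o) :
    (∃ a, o = some a ∧ IsOptimal a.bits) ↔ threshold o ≤ energy x₀ := by
  cases o with
  | none => simp [threshold]
  | some a =>
    have h := ho a rfl
    simp only [Option.some.injEq, exists_eq_left', threshold, h, Nat.cast_le]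
    exact ⟨fun h' => h' x₀, fun h' y => h'.trans (hx₀ y)⟩

/-- Markov's inequality for the whole loop: at `calls = B` it bounds the failure probability by
`loopBound / B`. Once the last sample is optimal, failure is impossible; otherwise one search is
paid for by the drop of the potential. -/
theorem innerLoop_bound (I : Implementation U) (L : ℕ) (hL : I.SizeLE L) (ε : ℝ) (w : ℝ)
    (ha : 5 ≤ attemptsPerScale ε) (hw : 4 * (attemptsPerScale ε : ℝ) + 32 ≤ w)
    {x₀ : BitString N} (hx₀ : IsOptimal x₀) (h0 : 0 < optProb U (energy x₀)) (B : ℕ)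
    (fuel calls : ℕ) (hfuel : calls ≤ fuel) (hB : calls ≤ B) (last : Option (Sample N))
    (hlast : IsConsistent last) (gates : ℕ) :
    B * prob (innerLoop I ε fuel calls last gates) (optimalRuns N)ᶜ + calls
      ≤ B + loopBound U (energy x₀) w (threshold last) := by
  have hw0 : 0 ≤ w := by have : (0 : ℝ) ≤ attemptsPerScale ε := Nat.cast_nonneg _; linarith
  have hB0 : (0 : ℝ) ≤ B := Nat.cast_nonneg B
  induction fuel generalizing calls last gates with
  | zero =>
    have h1 := mul_le_mul_of_nonneg_left
      (prob_le_one (innerLoop I ε 0 calls last gates) (optimalRuns N)ᶜ) hB0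
    have h2 := loopBound_nonneg h0 hw0 (threshold last)
    have h3 : (calls : ℝ) = 0 := by exact_mod_cast Nat.le_zero.1 hfuel
    linarith
  | succ fuel ih =>
    by_cases hs : threshold last ≤ energy x₀
    · have hz : prob (innerLoop I ε (fuel + 1) calls last gates) (optimalRuns N)ᶜ = 0 := by
        rw [prob, (PMF.toOuterMeasure_apply_eq_zero_iff _ _).2, ENNReal.toReal_zero]
        rw [Set.disjoint_compl_right_iff_subset]
        intro r hr
        obtain ⟨h1, h2, -⟩ := innerLoop_support I L hL ε _ _ _ _ hlast r hr
        exact (exists_optimal_iff hx₀ h1).2 (h2.trans hs)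
      have h2 := loopBound_nonneg h0 hw0 (threshold last)
      have h3 : (calls : ℝ) ≤ B := by exact_mod_cast hB
      rw [hz]
      linarith
    · have hP : 0 < markedProb U (threshold last) := h0.trans_le (optProb_le hs)
      have hP1 := I.markedProb_le_one (threshold last)
      obtain ⟨W, hW0, hW, hWb⟩ := exists_searchBound hP hP1 (attemptsPerScale ε) ha
        (hitProb (markedProb U (threshold last))) (hitProb_nonneg I _) (by
          intro m hm
          simp only [hitProb_eq I]
          exact quarter_le_sum_sin_sq hP hP1 m hm)
      have h1 := eqSearch_bind_bound I (threshold last) ε hP B (optimalRuns N)ᶜ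
        (fun r => match r.found with
          | some a => innerLoop I ε fuel r.callsLeft (some a) r.gates
          | none => PMF.pure ⟨last, r.gates⟩)
        (loopBound U (energy x₀) w) (loopBound_nonneg h0 hw0) W hW0 hW calls (by
          intro x c g _ hc
          exact ih c (by omega) (by omega) (some ⟨x, energy x⟩)
            (fun a ha => by obtain rfl := Option.some.inj ha; rfl) g) calls le_rfl 0 gates
      have h2 := conditionalMean_loopBound_le hx₀ h0 hw0 hs
      have h3 : (4 * (attemptsPerScale ε : ℝ) + 32) * (1 / √(markedProb U (threshold last)))
          ≤ w * (1 / √(markedProb U (threshold last))) :=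
        mul_le_mul_of_nonneg_right hw (by positivity)
      rw [innerLoop]
      exact h1.trans (by linarith)

end InnerLoop

/-! ### Independent repetitions of the loop. -/

section Repetition

variable {N : ℕ} {U : Matrix (BitString N) (BitString N) ℂ}

theorem threshold_better (a b : Option (Sample N)) :
    threshold (better a b) = min (threshold a) (threshold b) := by
  rw [better]
  split
  · next h => exact (min_eq_right h.le).symm
  · next h => exact (min_eq_left (not_lt.1 h)).symm

theorem IsConsistent.better {a b : Option (Sample N)} (ha : IsConsistent a)
    (hb : IsConsistent b) : IsConsistent (better a b) := by
  rw [LABS.better]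
  split
  · exact hb
  · exact ha

theorem isConsistent_none : IsConsistent (none : Option (Sample N)) := fun a ha => by simp at ha

theorem repeatedMinFind_support (I : Implementation U) (L : ℕ) (hL : I.SizeLE L) (ε : ℝ)
    (calls n : ℕ) (r : RunResult N) (hr : r ∈ (repeatedMinFind I ε calls n).support) :
    IsConsistent r.output ∧ r.gates ≤ n * (L * calls) := by
  induction n generalizing r with
  | zero =>
    rw [repeatedMinFind, PMF.mem_support_pure_iff] at hr
    subst hr
    exact ⟨isConsistent_none, Nat.zero_le _⟩
  | succ n ih =>
    simp only [repeatedMinFind, PMF.mem_support_bind_iff, PMF.mem_support_pure_iff] at hr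
    obtain ⟨p, hp, q, hq, rfl⟩ := hr
    obtain ⟨h1, h2⟩ := ih p hp
    obtain ⟨h3, -, h4⟩ := innerLoop_support I L hL _ _ _ _ _ isConsistent_none q hq
    refine ⟨h1.better h3, ?_⟩
    rw [Nat.succ_mul]
    simp only
    omega

/-- The better of two results is optimal exactly when one of them is, so failure requires both
independent parts to fail. -/
theorem repeatedMinFind_fail (I : Implementation U) (L : ℕ) (hL : I.SizeLE L) (ε : ℝ)
    (calls : ℕ) {x₀ : BitString N} (hx₀ : IsOptimal x₀) (c : ENNReal)
    (hc : (innerLoop I ε calls calls none 0).toOuterMeasure (optimalRuns N)ᶜ ≤ c) (n : ℕ) :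
    (repeatedMinFind I ε calls n).toOuterMeasure (optimalRuns N)ᶜ ≤ c ^ n := by
  induction n with
  | zero => rw [pow_zero]; exact toOuterMeasure_le_one _ _
  | succ n ih =>
    rw [repeatedMinFind, PMF.toOuterMeasure_bind_apply, pow_succ]
    refine le_trans ?_ (mul_le_mul_left ih c)
    rw [PMF.toOuterMeasure_apply, ← ENNReal.tsum_mul_right]
    refine ENNReal.tsum_le_tsum fun r => ?_
    -- Measured values are known to equal energies only on the support; other results have weight 0.
    by_cases hr : r ∈ (repeatedMinFind I ε calls n).support
    · obtain ⟨hr1, -⟩ := repeatedMinFind_support I L hL ε calls n r hr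
      have hmap : (innerLoop I ε calls calls none 0).bind (fun r' =>
          PMF.pure (⟨better r.output r'.output, r.gates + r'.gates⟩ : RunResult N))
          = (innerLoop I ε calls calls none 0).map fun r' =>
            ⟨better r.output r'.output, r.gates + r'.gates⟩ := rfl
      rw [hmap, PMF.toOuterMeasure_map_apply]
      have hgood : ∀ r' ∈ (innerLoop I ε calls calls none 0).support,
          ((⟨better r.output r'.output, r.gates + r'.gates⟩ : RunResult N) ∈ optimalRuns N ↔
            r ∈ optimalRuns N ∨ r' ∈ optimalRuns N) := by
        intro r' hr'
        obtain ⟨h3, -⟩ := innerLoop_support I L hL _ _ _ _ _ isConsistent_none r' hr'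
        have e1 := exists_optimal_iff hx₀ (hr1.better h3)
        have e2 := exists_optimal_iff hx₀ hr1
        have e3 := exists_optimal_iff hx₀ h3
        rw [threshold_better, min_le_iff, ← e2, ← e3] at e1
        exact e1
      by_cases hopt : r ∈ optimalRuns N
      · rw [(PMF.toOuterMeasure_apply_eq_zero_iff _ _).2]
        · simp
        · rw [Set.disjoint_left]
          intro r' hr' h
          exact h ((hgood r' hr').2 (Or.inl hopt))
      · rw [Set.indicator_of_mem (show r ∈ (optimalRuns N)ᶜ from hopt)]
        refine mul_le_mul_right ((PMF.toOuterMeasure_mono _ ?_).trans hc) _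
        rintro r' ⟨h1, h2⟩ h3
        exact h1 ((hgood r' h2).2 (Or.inr h3))
    · rw [(PMF.apply_eq_zero_iff _ _).2 hr, zero_mul]
      exact zero_le

end Repetition

/-! ### Numerical constants and the success probability. -/

section Parameters

theorem attemptsPerScale_bounds (N : ℕ) (hN : 3 ≤ N) :
    5 ≤ attemptsPerScale (1 / (6 * 2 ^ N)) ∧ attemptsPerScale (1 / (6 * 2 ^ N)) ≤ 3 * N + 9 := by
  have h6a : Real.logb 2 6 ≤ 3 := by
    rw [Real.logb_le_iff_le_rpow one_lt_two (by norm_num)]; norm_num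
  have h6b : 0 ≤ Real.logb 2 6 := Real.logb_nonneg one_lt_two (by norm_num)
  have hlog : Real.logb 2 (1 / (1 / (6 * 2 ^ N))) = Real.logb 2 6 + N := by
    rw [one_div_one_div, Real.logb_mul (by norm_num) (by positivity), Real.logb_pow,
      Real.logb_self_eq_one one_lt_two, mul_one]
  have hN' : (3 : ℝ) ≤ N := by exact_mod_cast hN
  rw [attemptsPerScale, hlog]
  constructor
  · have h := Nat.le_ceil (3 * (Real.logb 2 6 + N))
    have : (5 : ℝ) ≤ (⌈3 * (Real.logb 2 6 + N)⌉₊ : ℝ) := by linarith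
    exact_mod_cast this
  · rw [Nat.ceil_le]
    push_cast
    linarith

theorem half_pow_repetitions_le {δ : ℝ} (h0 : 0 < δ) :
    ((2 : ENNReal)⁻¹) ^ repetitions δ ≤ ENNReal.ofReal δ := by
  have h1 := Nat.le_ceil (Real.logb 2 (1 / δ))
  rw [Real.logb_le_iff_le_rpow one_lt_two (by positivity), Real.rpow_natCast] at h1
  have h2 : ((2 : ℝ)⁻¹) ^ repetitions δ ≤ δ := by
    rw [inv_pow, inv_le_comm₀ (by positivity) h0, ← one_div]
    exact h1
  calc ((2 : ENNReal)⁻¹) ^ repetitions δ = ENNReal.ofReal (((2 : ℝ)⁻¹) ^ repetitions δ) := by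
        rw [ENNReal.ofReal_pow (by norm_num), ENNReal.ofReal_inv_of_pos two_pos,
          ENNReal.ofReal_ofNat]
    _ ≤ _ := ENNReal.ofReal_le_ofReal h2

variable {N : ℕ} {U : Matrix (BitString N) (BitString N) ℂ}

theorem innerLoop_fail_le_half (I : Implementation U) (L : ℕ) (hL : I.SizeLE L) (hN : 3 ≤ N)
    {x₀ : BitString N} (hx₀ : IsOptimal x₀) {p : ℝ} (hp : 0 < p)
    (hpx : √p ≤ ‖U x₀ fun _ => false‖) {C M : ℝ} (hC : 60 ≤ C) (hM : 1 / √p ≤ M) :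
    (innerLoop I (1 / (6 * 2 ^ N)) ⌊3 * C * M * N⌋₊ ⌊3 * C * M * N⌋₊ none 0).toOuterMeasure
      (optimalRuns N)ᶜ ≤ 2⁻¹ := by
  obtain ⟨ha1, ha2⟩ := attemptsPerScale_bounds N hN
  have hN' : (3 : ℝ) ≤ N := by exact_mod_cast hN
  have ha2' : (attemptsPerScale (1 / (6 * 2 ^ N)) : ℝ) ≤ 3 * N + 9 := by exact_mod_cast ha2
  have hsp : 0 < √p := Real.sqrt_pos.2 hp
  have hopt : ‖U x₀ fun _ => false‖ ^ 2 ≤ optProb U (energy x₀) := by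
    have h1 : (energy x₀ : ℕ∞) < ((energy x₀ + 1 : ℕ) : ℕ∞) := by exact_mod_cast Nat.lt_succ_self _
    have h2 := Finset.single_le_sum (f := fun x : BitString N =>
      if (energy x : ℕ∞) < ((energy x₀ + 1 : ℕ) : ℕ∞) then ‖U x fun _ => false‖ ^ 2 else 0)
      (fun x _ => by split <;> positivity) (Finset.mem_univ x₀)
    simp only [h1, if_true] at h2
    exact h2
  have hp0 : p ≤ optProb U (energy x₀) := by
    refine le_trans ?_ hopt
    rw [← Real.sq_sqrt hp.le]
    exact pow_le_pow_left₀ hsp.le hpx 2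
  have hP1 : optProb U (energy x₀) ≤ 1 := I.markedProb_le_one _
  have h0 : 0 < optProb U (energy x₀) := hp.trans_le hp0
  have hinv : 1 / √(optProb U (energy x₀)) ≤ M :=
    (one_div_le_one_div_of_le hsp (Real.sqrt_le_sqrt hp0)).trans hM
  have hM1 : 1 ≤ M := by
    refine le_trans ?_ hM
    rw [le_div_iff₀ hsp, one_mul]
    exact Real.sqrt_le_one.2 (hp0.trans hP1)
  -- The choice w = 40N works because 4(3N + 9) + 32 = 12N + 68 ≤ 40N for N ≥ 3.
  have hbound := innerLoop_bound I L hL (1 / (6 * 2 ^ N)) (40 * N) ha1 (by linarith) hx₀ h0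
    ⌊3 * C * M * N⌋₊ ⌊3 * C * M * N⌋₊ ⌊3 * C * M * N⌋₊ le_rfl le_rfl none isConsistent_none 0
  have hle := loopBound_le (U := U) (e₀ := energy x₀) (w := 40 * N) (by positivity)
    (threshold (none : Option (Sample N)))
  have h2 : 2 * (40 * N) * (1 / √(optProb U (energy x₀))) ≤ 2 * (40 * N) * M :=
    mul_le_mul_of_nonneg_left hinv (by positivity)
  have hMN : 3 ≤ M * N := by nlinarith
  have hfloor := Nat.lt_floor_add_one (3 * C * M * N)
  have hCMN : 180 * (M * N) ≤ 3 * C * M * N := by nlinarith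
  set B := ⌊3 * C * M * N⌋₊
  -- The floor loses less than 1 ≤ 20MN from 180MN. The potential is at most 80MN, half of this
  -- bound, so failure has probability at most 1/2.
  have hB : 160 * (M * N) ≤ B := by linarith
  set q := prob (innerLoop I (1 / (6 * 2 ^ N)) B B none 0) (optimalRuns N)ᶜ with hq
  have hBq : B * q ≤ B * 2⁻¹ := by linarith
  have hq2 : q ≤ 2⁻¹ := le_of_mul_le_mul_left hBq (by linarith)
  rw [hq, prob] at hq2
  have := ENNReal.ofReal_le_ofReal hq2
  rwa [ENNReal.ofReal_toReal (toOuterMeasure_ne_top _ _), ENNReal.ofReal_inv_of_pos two_pos,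
    ENNReal.ofReal_ofNat] at this

theorem minimumFinding_success (I : Implementation U) (L : ℕ) (hL : I.SizeLE L) (hN : 3 ≤ N)
    {x₀ : BitString N} (hx₀ : IsOptimal x₀) {p : ℝ} (hp : 0 < p)
    (hpx : √p ≤ ‖U x₀ fun _ => false‖) {C M δ : ℝ} (hC : 60 ≤ C) (hM : 1 / √p ≤ M) (hδ : 0 < δ) :
    ENNReal.ofReal (1 - δ) ≤ (minimumFinding I C M δ).toOuterMeasure (optimalRuns N) := by
  have h1 := (repeatedMinFind_fail I L hL (1 / (6 * 2 ^ N)) ⌊3 * C * M * N⌋₊ hx₀ 2⁻¹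
    (innerLoop_fail_le_half I L hL hN hx₀ hp hpx hC hM) (repetitions δ)).trans
    (half_pow_repetitions_le hδ)
  have h2 : (minimumFinding I C M δ).toOuterMeasure Set.univ = 1 :=
    (PMF.toOuterMeasure_apply_eq_one_iff _ _).2 (Set.subset_univ _)
  have h3 := MeasureTheory.measure_union_le (μ := (minimumFinding I C M δ).toOuterMeasure)
    (optimalRuns N) (optimalRuns N)ᶜ
  rw [Set.union_compl_self, h2] at h3
  rw [ENNReal.ofReal_sub _ hδ.le, ENNReal.ofReal_one, tsub_le_iff_right]
  exact h3.trans (add_le_add_right h1 _)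

end Parameters

end LABS

end

theorem theorem1 :
    ∃ C₀ : ℝ, 0 < C₀ ∧ ∀ C : ℝ, C₀ ≤ C →
      ∀ d : ℕ, ∃ P : Polynomial ℕ,
        ∀ N : ℕ, 3 ≤ N → ∀ γ β : Fin d → ℝ,
          ∃ I : LABS.Implementation (LABS.qaoaUnitary N d γ β),
            ∀ xstar : LABS.BitString N, LABS.IsOptimal xstar →
            ∀ popt : ℝ, 0 < popt → Real.sqrt popt ≤ ‖LABS.qaoaAmplitude N d γ β xstar‖ →
            ∀ M : ℝ, 1 / Real.sqrt popt ≤ M →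
            ∀ δ : ℝ, 0 < δ → δ < 1 →
              ENNReal.ofReal (1 - δ) ≤ (LABS.minimumFinding I C M δ).toOuterMeasure
                  {r | ∃ a, r.output = some a ∧ LABS.IsOptimal a.bits} ∧
              ∀ r ∈ (LABS.minimumFinding I C M δ).support,
                (r.gates : ℝ) ≤ ((P.eval N : ℕ) : ℝ) * (LABS.repetitions δ : ℝ) * M := by
  -- The constant 60 comes from `innerLoop_fail_le_half`. The polynomial is the circuit size times
  -- ⌈3C⌉N, because a run makes at most ⌈3C⌉MN calls.
  refine ⟨60, by norm_num, fun C hC d =>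
    ⟨LABS.sizePolynomial d * Polynomial.C ⌈3 * C⌉₊ * Polynomial.X, fun N hN γ β =>
      ⟨LABS.qaoaImplementation N d γ β, fun x₀ hx₀ p hp hpx M hM δ hδ _ => ?_⟩⟩⟩
  have hL := LABS.sizeLE_qaoaImplementation N d γ β
  refine ⟨LABS.minimumFinding_success _ _ hL hN hx₀ hp hpx hC hM hδ, fun r hr => ?_⟩
  obtain ⟨-, h⟩ := LABS.repeatedMinFind_support _ _ hL _ _ _ r hr
  have hM0 : 0 ≤ M := le_trans (by positivity) hM
  have h1 : (⌊3 * C * M * N⌋₊ : ℝ) ≤ ⌈3 * C⌉₊ * M * N := by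
    refine (Nat.floor_le (by positivity)).trans ?_
    have := Nat.le_ceil (3 * C)
    gcongr
  have h2 : (r.gates : ℝ) ≤ LABS.repetitions δ *
      ((LABS.sizePolynomial d).eval N * ⌊3 * C * M * N⌋₊) := by exact_mod_cast h
  refine h2.trans ?_
  rw [Polynomial.eval_mul, Polynomial.eval_mul, Polynomial.eval_C, Polynomial.eval_X]
  push_cast
  calc _ ≤ (LABS.repetitions δ : ℝ) *
        ((LABS.sizePolynomial d).eval N * (⌈3 * C⌉₊ * M * N)) := by gcongr
    _ = _ := by ring
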